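/- **Superfunctions.** Let $A$ be a commutative ring. For $N\ge 0$ let $\mathscr P_N(A)$ be the ring of superpolynomials over $A$ in commuting variables $x_1,\dots,x_N$ and mutually anticommuting variables $\phi_1,\dots,\phi_N,\theta_1,\dots,\theta_N$ (all squaring to zero and commuting with the $x_i$). The symmetric group $S_N$ acts by permuting the triples $(x_i,\phi_i,\theta_i)$ simultaneously. The ring $\mathscr P^{S_\infty}(A)$ of $\mathcal N=2$ symmetric superfunctions consists of the sequences $(f_N)_{N\ge 0}$ of $S_N$-invariant elements $f_N\in\mathscr P_N(A)$ such that setting $x_{N+1}=\phi_{N+1}=\theta_{N+1}=0$ in $f_{N+1}$ gives $f_N$, and such that the total degrees of the $f_N$ in all variables are bounded. **Superpartitions.** An $\mathcal N=2$ superpartition $\Lambda=(\Lambda_1,\dots,\Lambda_\ell)$ is a finite sequence of nonnegative integers, each of which may be overlined, underlined, both, or neither. Its parts are ordered by decreasing value and, for equal values, in the order: both marks, overlined, underlined, unmarked. Parts with exactly one mark are pairwise distinct, unmarked parts are positive, and marked parts may be zero. Write $|\Lambda_i|$ for the numerical value of $\Lambda_i$. The sector of $\Lambda$ is $(n|\overline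 m,\underline m)$, where $n=\sum_i|\Lambda_i|$ and $\overline m$ (resp. $\underline m$) is the number of parts carrying an overline (resp. an underline). The weight of a part of value $a$ is $w=a$, $a+\frac12$ or $a+1$ if it has zero, one or two marks, and $w(\Lambda_i)=0$ for $i>\ell$. The weight ordering is $$\Gamma>\Lambda\iff \sum_{i=1}^n w(\Gamma_i)\ge\sum_{i=1}^n w(\Lambda_i)\ \text{ for all } n,\ \text{ with strict inequality for some } n .$$ **Monomials and power sums.** For a part $q$ put $t_i(q)=\phi_i^{\overline\epsilon}\,\theta_i^{\underline\epsilon}\,x_i^{|q|}$, where $\overline\epsilon$ (resp. $\underline\epsilon$) is $1$ if $q$ has an overline (resp. an underline) and $0$ otherwise. The monomial $m_\Lambda$ is, in $N\ge\ell$ variables, the sum of the distinct $S_N$-images of the ordered product $t_1(\Lambda_1)t_2(\Lambda_2)\cdots t_\ell(\Lambda_\ell)$; it is $0$ in $N<\ell$ variables. The power sum is the ordered product $p_\Lambda=p_{\Lambda_1}p_{\Lambda_2}\cdots p_{\Lambda_\ell}$, where $p_q=\sum_{i} t_i(q)$ for a part $q$. **Proposition.** 1. There are integers $a_{\Lambda,\Gamma}$,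 independent of $A$, such that for every commutative ring $A$ and every superpartition $\Lambda$ $$p_\Lambda=a_\Lambda m_\Lambda+\sum_{\Gamma>\Lambda}a_{\Lambda,\Gamma}\,m_\Gamma,\qquad a_\Lambda=\prod_{q}n_\Lambda(q)!,$$ where the (finite) sum is over superpartitions $\Gamma>\Lambda$ in the same sector as $\Lambda$, the product is over the different (marked) parts $q$ of $\Lambda$, and $n_\Lambda(q)$ is the number of occurrences of $q$ in $\Lambda$. 2. The power sums $p_\Lambda$, for $\Lambda$ running over all $\mathcal N=2$ superpartitions, form a basis of $\mathscr P^{S_\infty}(\mathbb Q)$ over $\mathbb Q$. -/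

import Mathlib

open scoped TensorProduct Nat

namespace SuperSym

/-! ### Superpolynomials in finitely many variables -/

/-- The ring of `𝒩 = 2` superpolynomials over `A` in the commuting variables `x i` and the
anticommuting variables `φ i`, `θ i`, for `i : Fin N`. The exterior algebra has the free generators
`φ i` (index `(i, false)`) and `θ i` (index `(i, true)`), all of which anticommute with each
other. -/
abbrev Superpoly (A : Type*) [CommRing A] (N : ℕ) : Type _ :=
  MvPolynomial (Fin N) A ⊗[A] ExteriorAlgebra A (Fin N × Bool → A)

/-- The commuting variable `x i`. -/
noncomputable def x (A : Type*) [CommRing A] {N : ℕ} (i : Fin N) : Superpoly A N :=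
  MvPolynomial.X i ⊗ₜ[A] 1

/-- The anticommuting variable `φ i`. -/
noncomputable def phi (A : Type*) [CommRing A] {N : ℕ} (i : Fin N) : Superpoly A N :=
  1 ⊗ₜ[A] ExteriorAlgebra.ι A (Pi.single (i, false) 1)

/-- The anticommuting variable `θ i`. -/
noncomputable def theta (A : Type*) [CommRing A] {N : ℕ} (i : Fin N) : Superpoly A N :=
  1 ⊗ₜ[A] ExteriorAlgebra.ι A (Pi.single (i, true) 1)

/-- The diagonal action of a permutation: it sends the triple `x i`, `φ i`, `θ i` to
`x (ω i)`, `φ (ω i)`, `θ (ω i)`. -/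
noncomputable def permute (A : Type*) [CommRing A] {N : ℕ} (ω : Equiv.Perm (Fin N)) :
    Superpoly A N →ₐ[A] Superpoly A N :=
  Algebra.TensorProduct.map (MvPolynomial.rename ω)
    (ExteriorAlgebra.map (LinearMap.funLeft A A fun k : Fin N × Bool => (ω.symm k.1, k.2)))

/-- Restriction from `N + 1` to `N` variables: it sets the last triple `x`, `φ`, `θ` to zero and
keeps all the other variables. -/
noncomputable def restrict (A : Type*) [CommRing A] (N : ℕ) :
    Superpoly A (N + 1) →ₐ[A] Superpoly A N :=
  Algebra.TensorProduct.map
    (MvPolynomial.aeval fun i : Fin (N + 1) =>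
      (Fin.lastCases 0 (fun j : Fin N => MvPolynomial.X j) i : MvPolynomial (Fin N) A))
    (ExteriorAlgebra.map (LinearMap.funLeft A A fun k : Fin N × Bool => (k.1.castSucc, k.2)))

/-- The set of all the variables `x i`, `φ i`, `θ i`. -/
def vars (A : Type*) [CommRing A] (N : ℕ) : Set (Superpoly A N) :=
  Set.range (x A) ∪ Set.range (phi A) ∪ Set.range (theta A)

/-- The elements of degree at most `d` in the elements of `s`: the linear combinations of products
of at most `d` elements of `s`. -/
def degLE (A : Type*) {B : Type*} [CommRing A] [Ring B] [Algebra A B] (s : Set B) (d : ℕ) :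
    Submodule A B :=
  Submodule.span A (insert 1 s) ^ d

theorem degLE_mul {A B : Type*} [CommRing A] [Ring B] [Algebra A B] {s : Set B} {d e : ℕ}
    {f g : B} (hf : f ∈ degLE A s d) (hg : g ∈ degLE A s e) : f * g ∈ degLE A s (d + e) := by
  rw [degLE, pow_add]
  exact Submodule.mul_mem_mul hf hg

theorem degLE_algebraMap {A B : Type*} [CommRing A] [Ring B] [Algebra A B] (s : Set B) (d : ℕ)
    (r : A) : algebraMap A B r ∈ degLE A s d := by
  have h : (1 : B) ∈ Submodule.span A (insert 1 s) := Submodule.subset_span (Set.mem_insert 1 s)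
  rw [Algebra.algebraMap_eq_smul_one]
  refine Submodule.smul_mem _ r ?_
  simpa [degLE] using Submodule.pow_mem_pow _ h d

theorem degLE_mono {A B : Type*} [CommRing A] [Ring B] [Algebra A B] {s : Set B} {d e : ℕ}
    (h : d ≤ e) {f : B} (hf : f ∈ degLE A s d) : f ∈ degLE A s e := by
  obtain ⟨k, rfl⟩ := Nat.exists_eq_add_of_le h
  simpa using degLE_mul hf (degLE_algebraMap (A := A) s k 1)

/-! ### Symmetric superfunctions in infinitely many variables -/

/-- The ring of `𝒩 = 2` symmetric superfunctions over `A` in infinitely many variables: sequences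
`(f N)` of symmetric superpolynomials in `N` variables that are compatible under restriction and of
bounded total degree in the variables `x`, `φ`, `θ`. -/
noncomputable def SymSuper (A : Type*) [CommRing A] : Subalgebra A (∀ N : ℕ, Superpoly A N) where
  carrier := {f |
    (∀ (N : ℕ) (ω : Equiv.Perm (Fin N)), permute A ω (f N) = f N) ∧
    (∀ N : ℕ, restrict A N (f (N + 1)) = f N) ∧
    ∃ d : ℕ, ∀ N : ℕ, f N ∈ degLE A (vars A N) d}
  mul_mem' := by
    rintro f g ⟨hf, hf', d, hd⟩ ⟨hg, hg', e, he⟩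
    refine ⟨fun N ω => ?_, fun N => ?_, d + e, fun N => ?_⟩
    · rw [Pi.mul_apply, map_mul, hf, hg]
    · rw [Pi.mul_apply, map_mul, hf', hg', Pi.mul_apply]
    · exact degLE_mul (hd N) (he N)
  add_mem' := by
    rintro f g ⟨hf, hf', d, hd⟩ ⟨hg, hg', e, he⟩
    refine ⟨fun N ω => ?_, fun N => ?_, max d e, fun N => ?_⟩
    · rw [Pi.add_apply, map_add, hf, hg]
    · rw [Pi.add_apply, map_add, hf', hg', Pi.add_apply]
    · exact add_mem (degLE_mono (le_max_left d e) (hd N)) (degLE_mono (le_max_right d e) (he N))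
  algebraMap_mem' := by
    intro r
    refine ⟨fun N ω => ?_, fun N => ?_, 0, fun N => ?_⟩
    · rw [Pi.algebraMap_apply, AlgHom.commutes]
    · rw [Pi.algebraMap_apply, AlgHom.commutes, Pi.algebraMap_apply]
    · exact degLE_algebraMap (vars A N) 0 r

/-! ### Superpartitions -/

/-- A part: a nonnegative integer which may be overlined, underlined, both, or neither. -/
structure Part where
  val : ℕ
  bar : Bool
  ubar : Bool
  deriving DecidableEq

/-- The rank of the marking, in the order: both marks, overlined, underlined, unmarked. -/
def Part.rank (p : Part) : ℕ := 2 * p.bar.toNat + p.ubar.toNat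

/-- `p` may stand before `q` in a superpartition: larger values come first, and for equal values
the order is: both marks, overlined, underlined, unmarked. -/
def Part.Before (p q : Part) : Prop :=
  q.val < p.val ∨ (q.val = p.val ∧ q.rank ≤ p.rank)

/-- The weight: `a`, `a + 1/2` or `a + 1` for a part of value `a` with zero, one or two marks. -/
def Part.weight (p : Part) : ℚ :=
  p.val + (p.bar.toNat + p.ubar.toNat) / 2

/-- An `𝒩 = 2` superpartition, given by its ordered list of parts. Unmarked zeros, which are
immaterial, are left out; zero is allowed for all the marked parts. -/
@[ext]
structure SPar where
  parts : List Part
  sorted : parts.Pairwise Part.Before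
  /-- Parts with exactly one mark are distinct. -/
  distinct : ∀ p ∈ parts, p.bar ≠ p.ubar → parts.count p = 1
  /-- Unmarked parts are positive. -/
  pos : ∀ p ∈ parts, p.bar = false → p.ubar = false → 0 < p.val

/-- The sector `(n | m̄, m̲)` of a superpartition: the sum of the values of the parts, the number of
parts with an overline and the number of parts with an underline. -/
def SPar.sector (Λ : SPar) : ℕ × ℕ × ℕ :=
  ((Λ.parts.map Part.val).sum, Λ.parts.countP Part.bar, Λ.parts.countP Part.ubar)

/-- The sum of the weights of the first `n` parts (of all the parts, if there are fewer). -/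
def SPar.partialWeight (Λ : SPar) (n : ℕ) : ℚ :=
  ((Λ.parts.take n).map Part.weight).sum

/-- The weight ordering: `Γ.WeightGT Λ` means `Γ > Λ`. -/
def SPar.WeightGT (Γ Λ : SPar) : Prop :=
  (∀ n : ℕ, Λ.partialWeight n ≤ Γ.partialWeight n) ∧
    ∃ n : ℕ, Λ.partialWeight n < Γ.partialWeight n

/-- The product of `n_Λ(p)!` over the different parts `p` of `Λ`, with `n_Λ(p)` the number of
occurrences in `Λ` of the part `p` with its marks. -/
def SPar.leadCoeff (Λ : SPar) : ℕ :=
  ∏ p ∈ Λ.parts.toFinset, (Λ.parts.count p)!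

/-! ### Monomials and power sums -/

/-- The product `φ_i ^ ε̄ * θ_i ^ ε̲ * x_i ^ |p|`, where `ε̄` (`ε̲`) is `1` if the part `p` has an
overline (underline) and `0` otherwise. -/
noncomputable def term (A : Type*) [CommRing A] {N : ℕ} (p : Part) (i : Fin N) : Superpoly A N :=
  phi A i ^ p.bar.toNat * theta A i ^ p.ubar.toNat * x A i ^ p.val

/-- The monomial `[φ; θ]_Λ x^Λ`, in `N` variables with `N` at least the length `ℓ` of `Λ`: the
product, from left to right, of the terms of the parts `Λ_1, ..., Λ_ℓ` in the first, ..., `ℓ`-th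
triple of variables. -/
noncomputable def leadingTerm (A : Type*) [CommRing A] {N : ℕ} (Λ : SPar)
    (h : Λ.parts.length ≤ N) : Superpoly A N :=
  (List.ofFn fun i : Fin Λ.parts.length => term A (Λ.parts.get i) (Fin.castLE h i)).prod

open Classical in
/-- The monomial symmetric superfunction `m_Λ`: in `N` variables it is the sum of the distinct
permutations of `[φ; θ]_Λ x^Λ`, and `0` if `N` is smaller than the length of `Λ`. -/
noncomputable def monomial (A : Type*) [CommRing A] (Λ : SPar) : ∀ N : ℕ, Superpoly A N :=
  fun N =>
    if h : Λ.parts.length ≤ N then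
      ∑ f ∈ Finset.univ.image
        (fun ω : Equiv.Perm (Fin N) => permute A ω (leadingTerm A Λ h)), f
    else 0

/-- The power sum of one part: `∑ x_i ^ n`, `∑ φ_i x_i ^ n`, `∑ θ_i x_i ^ n` or
`∑ φ_i θ_i x_i ^ n`, according to the marks. -/
noncomputable def powerSumPart (A : Type*) [CommRing A] (p : Part) : ∀ N : ℕ, Superpoly A N :=
  fun N => ∑ i : Fin N, term A p i

/-- The power sum `p_Λ`: the product, from left to right, of the power sums of its parts. -/
noncomputable def powerSum (A : Type*) [CommRing A] (Λ : SPar) : ∀ N : ℕ, Superpoly A N :=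
  (Λ.parts.map (powerSumPart A)).prod

end SuperSym

/-!
The ordered products `termBasis A N f` of the terms `φ_i ^ ε̄ * θ_i ^ ε̲ * x_i ^ a`, one part `f i`
for each position `i`, form a basis of the ring of superpolynomials. This comes from the basis of
the exterior algebra, up to signs, and the sign bookkeeping reduces to one statement
(`exists_termProd_eq`, `termProd_eq_zero`): any product of terms is plus or minus the basis element
with the same exponents, or zero if an odd variable is repeated.

A symmetric superpolynomial over a ring without 2-torsion is determined by its coefficients at the
leading terms of the superpartitions (`eq_zero_of_repr_pad_eq_zero`). Indeed every function from the
positions to the parts can be permuted into the parts of a superpartition followed by zeros, unless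
a part with exactly one mark is repeated, and in that case a transposition changes the sign of the
monomial, so that its coefficient `c` satisfies `c = -c`. Since these coefficients are stable under
restriction and the degrees are bounded, every symmetric superfunction is a finite combination of
the monomials `m_Λ` (`exists_eq_sum_monomial`).

Expanding the product of sums, `p_Λ` is the sum over all maps `g` from the parts of `Λ` to the
positions of the corresponding product of terms. If the leading term of `Γ` occurs in it, then the
parts of `Γ` are obtained by merging the parts of `Λ` along a surjection `g`. Marks and values add
up under merging, so the sector is kept; the first `n` parts of `Λ` are merged into at most `n`
parts of `Γ`, and the sum of these is at most that of the first `n` parts of `Γ`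
(`merge_partialWeight_le`). If `Γ ≠ Λ` then `Γ` is strictly shorter than `Λ`, and the inequality is
strict when `n` is the length of `Γ`. The maps `g` that contribute to `Γ = Λ` are the permutations
of equal parts, which are products of central factors, so that each contributes `1`
(`coeff_powerSum_self`).

The first assertion is proved over `ℤ` and transported to any nontrivial ring along the canonical
map, which keeps the distinct monomials of an orbit distinct (`baseChange_monomial`). For the
second, the expansion is triangular with respect to the length of the superpartitions, with diagonal
coefficients that are invertible in `ℚ`.
-/

namespace SuperSym

/-! ### Products of basis vectors in an exterior algebra -/

section Exterior

theorem prod_map_ι_of_not_nodup {R M I : Type*} [CommRing R] [AddCommGroup M] [Module R M]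
    (b : I → M) {l : List I} (h : ¬ l.Nodup) :
    (l.map fun i => ExteriorAlgebra.ι R (b i)).prod = 0 := by
  have : (l.map fun i => ExteriorAlgebra.ι R (b i)).prod =
      ExteriorAlgebra.ιMulti R l.length fun k => b l[k] := by
    rw [ExteriorAlgebra.ιMulti_apply]
    congr 1
    conv_lhs => rw [← List.ofFn_getElem (xs := l), List.map_ofFn]
    rfl
  rw [this]
  apply ExteriorAlgebra.ιMulti_eq_zero_of_not_inj
  intro hi
  exact h (List.nodup_iff_injective_getElem.2 fun x y hxy => hi (congrArg b hxy))

variable {R M I : Type*} [CommRing R] [AddCommGroup M] [Module R M] [LinearOrder I]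
  (b : Module.Basis I R M)

theorem exteriorBasis_singleton (i : I) :
    b.ExteriorAlgebra {i} = ExteriorAlgebra.ι R (b i) := by
  rw [ExteriorAlgebra.basis_apply_ofCard b (n := 1) (Finset.card_singleton i),
    ExteriorAlgebra.ιMulti_family,
    ExteriorAlgebra.ιMulti_succ_apply]
  have h := Finset.orderEmbOfFin_mem {i} (Finset.card_singleton i) 0
  rw [Finset.mem_singleton] at h
  simp [Set.powersetCard.ofFinEmbEquiv_symm_apply, h]

theorem prod_map_ι_of_nodup {l : List I} (h : l.Nodup) : ∃ u : ℤˣ,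
    (l.map fun i => ExteriorAlgebra.ι R (b i)).prod = u • b.ExteriorAlgebra l.toFinset := by
  induction l with
  | nil =>
    refine ⟨1, ?_⟩
    have := ExteriorAlgebra.basis_apply_ofCard b (n := 0) (s := ∅) rfl
    simp [this]
  | cons i l ih =>
    obtain ⟨u, hu⟩ := ih h.of_cons
    have hd : Disjoint ({i} : Finset I) l.toFinset := by
      simpa using (List.nodup_cons.1 h).1
    have := ExteriorAlgebra.basis_mul_of_disjoint b
      (s := ⟨{i}, Finset.card_singleton i⟩) (t := ⟨l.toFinset, rfl⟩) hd
    refine ⟨u * Equiv.Perm.sign (Set.powersetCard.permOfDisjoint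
      (s := ⟨{i}, Finset.card_singleton i⟩) (t := ⟨l.toFinset, rfl⟩) hd), ?_⟩
    rw [List.map_cons, List.prod_cons, hu, ← exteriorBasis_singleton, mul_smul_comm, mul_smul]
    refine congrArg (u • ·) (this.trans ?_)
    congr 2
    ext; simp

end Exterior

/-! ### The basis of ordered products of terms -/

/-- The unmarked zero, which does not occur in superpartitions. Its terms are `1`, so it stands for
an unoccupied position. -/
instance : Zero Part := ⟨⟨0, false, false⟩⟩

/-- The exponents of `x`, `φ` and `θ` in a term with the part `p`. -/
def Part.deg (p : Part) : ℕ × ℕ × ℕ := (p.val, p.bar.toNat, p.ubar.toNat)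

theorem Part.deg_zero : (0 : Part).deg = 0 := rfl

theorem Part.deg_injective : Function.Injective Part.deg := by
  rintro ⟨a, b, c⟩ ⟨a', b', c'⟩ h
  simp only [deg, Prod.mk.injEq] at h
  obtain ⟨rfl, hb, hc⟩ := h
  cases b <;> cases b' <;> cases c <;> cases c' <;> simp_all

theorem Part.deg_eq_zero {p : Part} : p.deg = 0 ↔ p = 0 :=
  ⟨fun h => deg_injective h, fun h => h ▸ rfl⟩

section Terms

variable (A : Type*) [CommRing A] {N : ℕ}

/-- The basis `φ i`, `θ i` of the odd generators, in the order `φ 0, θ 0, φ 1, θ 1, …`. -/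
noncomputable def oddBasis (N : ℕ) : Module.Basis (Fin N ×ₗ Bool) A (Fin N × Bool → A) :=
  (Pi.basisFun A (Fin N × Bool)).reindex toLex

/-- The odd generators that occur in `term A p i`, from left to right. -/
def oddVars (p : Part × Fin N) : List (Fin N ×ₗ Bool) :=
  List.replicate p.1.bar.toNat (toLex (p.2, false)) ++
    List.replicate p.1.ubar.toNat (toLex (p.2, true))

/-- The product of the terms `term A p i`, for `(p, i)` in the list, from left to right. -/
noncomputable def termProd (l : List (Part × Fin N)) : Superpoly A N :=
  (l.map fun p => term A p.1 p.2).prod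

/-- The exponents of `x i`, `φ i`, `θ i` in a product of terms, for each position `i`. -/
def totalDeg (l : List (Part × Fin N)) : Fin N → ℕ × ℕ × ℕ :=
  (l.map fun p => Pi.single p.2 p.1.deg).sum

theorem termProd_cons (p : Part × Fin N) (l : List (Part × Fin N)) :
    termProd A (p :: l) = term A p.1 p.2 * termProd A l := by
  simp [termProd]

theorem termProd_append (l l' : List (Part × Fin N)) :
    termProd A (l ++ l') = termProd A l * termProd A l' := by
  simp [termProd]

theorem totalDeg_cons (p : Part × Fin N) (l : List (Part × Fin N)) :
    totalDeg (p :: l) = Pi.single p.2 p.1.deg + totalDeg l := by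
  simp [totalDeg]

theorem term_eq_tmul (p : Part) (i : Fin N) :
    term A p i = MvPolynomial.monomial (Finsupp.single i p.val) 1 ⊗ₜ[A]
      ((oddVars (p, i)).map fun k => ExteriorAlgebra.ι A (oddBasis A N k)).prod := by
  simp only [term, phi, theta, x, oddVars, Algebra.TensorProduct.tmul_pow, one_pow,
    Algebra.TensorProduct.tmul_mul_tmul, one_mul, mul_one, List.map_append, List.prod_append,
    List.map_replicate, List.prod_replicate, oddBasis, Module.Basis.reindex_apply,
    Pi.basisFun_apply]
  rw [MvPolynomial.X_pow_eq_monomial]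
  rfl

theorem termProd_eq_tmul (l : List (Part × Fin N)) :
    termProd A l = MvPolynomial.monomial (Finsupp.equivFunOnFinite.symm fun i => (totalDeg l i).1) 1
      ⊗ₜ[A] ((l.flatMap oddVars).map fun k => ExteriorAlgebra.ι A (oddBasis A N k)).prod := by
  induction l with
  | nil =>
    have : (Finsupp.equivFunOnFinite.symm
        fun i => (totalDeg ([] : List (Part × Fin N)) i).1) = 0 := by
      ext; simp [totalDeg]
    rw [this]
    simp [termProd, Algebra.TensorProduct.one_def]
  | cons p l ih =>
    rw [termProd_cons, ih, term_eq_tmul, Algebra.TensorProduct.tmul_mul_tmul,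
      MvPolynomial.monomial_mul, one_mul, List.flatMap_cons, List.map_append, List.prod_append]
    congr 2
    congr 1
    ext i
    by_cases h : i = p.2
    · subst h; simp [totalDeg_cons, Part.deg]
    · simp [totalDeg_cons, h]

theorem count_oddVars (l : List (Part × Fin N)) (i : Fin N) :
    (l.flatMap oddVars).count (toLex (i, false)) = (totalDeg l i).2.1 ∧
    (l.flatMap oddVars).count (toLex (i, true)) = (totalDeg l i).2.2 := by
  induction l with
  | nil => simp [totalDeg]
  | cons p l ih =>
    obtain ⟨h1, h2⟩ := ih
    rw [List.flatMap_cons, List.count_append, List.count_append, h1, h2]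
    by_cases h : i = p.2
    · subst h; simp [totalDeg_cons, Part.deg, oddVars, List.count_replicate]
    · simp [totalDeg_cons, h, oddVars, List.count_replicate, Ne.symm h]

/-- Functions with values in the parts, split into the exponents of the commuting variables and
the set of the anticommuting variables. -/
noncomputable def partsEquiv (N : ℕ) :
    (Fin N → Part) ≃ (Fin N →₀ ℕ) × Finset (Fin N ×ₗ Bool) where
  toFun f := (Finsupp.equivFunOnFinite.symm fun i => (f i).val,
    Finset.univ.filter fun k => if (ofLex k).2 then (f (ofLex k).1).ubar else (f (ofLex k).1).bar)
  invFun m i := ⟨m.1 i, decide (toLex (i, false) ∈ m.2), decide (toLex (i, true) ∈ m.2)⟩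
  left_inv f := by
    funext i; simp
  right_inv m := by
    refine Prod.ext ?_ ?_
    · ext; simp
    · ext k
      obtain ⟨⟨i, b⟩, rfl⟩ := toLex.surjective k
      cases b <;> simp

/-- The basis of normally ordered monomials in all the variables, with the products of the odd
variables taken from the basis of the exterior algebra. -/
noncomputable def auxBasis (N : ℕ) : Module.Basis (Fin N → Part) A (Superpoly A N) :=
  ((MvPolynomial.basisMonomials (Fin N) A).tensorProduct (oddBasis A N).ExteriorAlgebra).reindex
    (partsEquiv N).symm

theorem exists_termProd_eq_smul_auxBasis {l : List (Part × Fin N)} {f : Fin N → Part}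
    (h : ∀ i, (f i).deg = totalDeg l i) : ∃ u : ℤˣ, termProd A l = u • auxBasis A N f := by
  have hc (i : Fin N) (b : Bool) : (l.flatMap oddVars).count (toLex (i, b)) =
      (if b then (f i).ubar else (f i).bar).toNat := by
    have := count_oddVars l i
    rw [← h i] at this
    cases b
    · simpa [Part.deg] using this.1
    · simpa [Part.deg] using this.2
  have hn : (l.flatMap oddVars).Nodup := by
    rw [List.nodup_iff_count_le_one]
    rintro ⟨i, b⟩
    exact (hc i b).le.trans (Bool.toNat_le _)
  obtain ⟨u, hu⟩ := prod_map_ι_of_nodup (oddBasis A N) hn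
  refine ⟨u, ?_⟩
  have he : partsEquiv N f = (Finsupp.equivFunOnFinite.symm fun i => (totalDeg l i).1,
      (l.flatMap oddVars).toFinset) := by
    refine Prod.ext ?_ ?_
    · ext i
      simp [partsEquiv, ← h i, Part.deg]
    · ext k
      obtain ⟨⟨i, b⟩, rfl⟩ := toLex.surjective k
      rw [List.mem_toFinset, ← List.count_pos_iff, hc i b]
      cases b <;> simp [partsEquiv, Nat.pos_iff_ne_zero]
  rw [termProd_eq_tmul, hu, auxBasis, Module.Basis.reindex_apply, Equiv.symm_symm, he,
    Module.Basis.tensorProduct_apply, MvPolynomial.coe_basisMonomials]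
  obtain rfl | rfl := Int.units_eq_one_or u
  · simp
  · simp only [Units.neg_smul, one_smul, TensorProduct.tmul_neg]

/-- A product of terms in which an odd variable is repeated is zero. -/
theorem termProd_eq_zero {l : List (Part × Fin N)}
    (h : ¬ ∃ f : Fin N → Part, ∀ i, (f i).deg = totalDeg l i) : termProd A l = 0 := by
  rw [termProd_eq_tmul, prod_map_ι_of_not_nodup, TensorProduct.tmul_zero]
  intro hn
  rw [List.nodup_iff_count_le_one] at hn
  refine h ⟨fun i => ⟨(totalDeg l i).1, decide ((totalDeg l i).2.1 = 1),
    decide ((totalDeg l i).2.2 = 1)⟩, fun i => ?_⟩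
  have h1 := hn (toLex (i, false))
  have h2 := hn (toLex (i, true))
  rw [(count_oddVars l i).1] at h1
  rw [(count_oddVars l i).2] at h2
  refine Prod.ext rfl (Prod.ext ?_ ?_) <;> dsimp only [Part.deg]
  · interval_cases (totalDeg l i).2.1 <;> rfl
  · interval_cases (totalDeg l i).2.2 <;> rfl

/-- The list of the parts of `f` with their positions. -/
def graphList (f : Fin N → Part) : List (Part × Fin N) := List.ofFn fun i => (f i, i)

theorem totalDeg_ofFn {n : ℕ} (q : Fin n → Part) (g : Fin n → Fin N) (i : Fin N) :
    totalDeg (List.ofFn fun k => (q k, g k)) i = ∑ k with g k = i, (q k).deg := by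
  simp only [totalDeg, List.map_ofFn, List.sum_ofFn, Finset.sum_apply, Function.comp_apply,
    Finset.sum_filter, Pi.single_apply]
  exact Finset.sum_congr rfl fun k _ => by simp only [eq_comm]

theorem totalDeg_graphList (f : Fin N → Part) (i : Fin N) :
    totalDeg (graphList f) i = (f i).deg := by
  have h : (Finset.univ.filter fun k => k = i) = {i} := by ext; simp
  rw [graphList, totalDeg_ofFn f fun i => i, h, Finset.sum_singleton]

theorem exists_sign (f : Fin N → Part) :
    ∃ u : ℤˣ, termProd A (graphList f) = u • auxBasis A N f :=
  exists_termProd_eq_smul_auxBasis A fun i => (totalDeg_graphList f i).symm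

/-- The basis of the ring of superpolynomials formed by the ordered products of the terms
`term A (f i) i`, for all functions `f` from the positions to the parts. -/
noncomputable def termBasis (N : ℕ) : Module.Basis (Fin N → Part) A (Superpoly A N) :=
  (auxBasis A N).unitsSMul fun f =>
    Units.map (Int.castRingHom A).toMonoidHom (exists_sign A f).choose

theorem intUnits_smul_eq {M : Type*} [AddCommGroup M] [Module A M] (u : ℤˣ) (m : M) :
    Units.map (Int.castRingHom A).toMonoidHom u • m = u • m := by
  obtain rfl | rfl := Int.units_eq_one_or u
  · simp
  · simp [Units.smul_def]

theorem termBasis_apply (f : Fin N → Part) : termBasis A N f = termProd A (graphList f) := by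
  rw [termBasis, Module.Basis.unitsSMul_apply, intUnits_smul_eq, ← (exists_sign A f).choose_spec]

/-- A product of terms is, up to a sign, the element of the basis with the same exponents. -/
theorem exists_termProd_eq {l : List (Part × Fin N)} {f : Fin N → Part}
    (h : ∀ i, (f i).deg = totalDeg l i) : ∃ u : ℤˣ, termProd A l = u • termBasis A N f := by
  obtain ⟨u, hu⟩ := exists_termProd_eq_smul_auxBasis A h
  obtain ⟨v, hv⟩ := exists_sign A f
  refine ⟨u * v⁻¹, ?_⟩
  rw [hu, termBasis_apply, hv, mul_smul, inv_smul_smul]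

theorem totalDeg_of_repr_ne_zero {l : List (Part × Fin N)} {f : Fin N → Part}
    (h : (termBasis A N).repr (termProd A l) f ≠ 0) (i : Fin N) : (f i).deg = totalDeg l i := by
  by_cases hl : ∃ f : Fin N → Part, ∀ i, (f i).deg = totalDeg l i
  · obtain ⟨f', hf'⟩ := hl
    obtain ⟨u, hu⟩ := exists_termProd_eq A hf'
    have : f' = f := by
      by_contra hne
      apply h
      obtain rfl | rfl := Int.units_eq_one_or u <;> simp [hu, hne]
    rw [← this, hf']
  · rw [termProd_eq_zero A hl] at h
    simp at h

end Terms

/-! ### The action of permutations and the restriction maps on terms -/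

section Action

variable (A : Type*) [CommRing A] {N : ℕ}

theorem term_zero (i : Fin N) : term A 0 i = 1 := by
  change phi A i ^ 0 * theta A i ^ 0 * x A i ^ 0 = 1
  simp

theorem permute_term (ω : Equiv.Perm (Fin N)) (p : Part) (i : Fin N) :
    permute A ω (term A p i) = term A p (ω i) := by
  have h (b : Bool) : (Pi.single (i, b) 1 : Fin N × Bool → A) ∘ (fun k => (ω.symm k.1, k.2)) =
      Pi.single (ω i, b) 1 := by
    funext k
    simp only [Function.comp_apply, Pi.single_apply, Prod.ext_iff, Equiv.symm_apply_eq]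
  have hx : permute A ω (x A i) = x A (ω i) := by simp [permute, x]
  have hφ : permute A ω (phi A i) = phi A (ω i) := by
    simp [permute, phi, LinearMap.funLeft, h]
  have hθ : permute A ω (theta A i) = theta A (ω i) := by
    simp [permute, theta, LinearMap.funLeft, h]
  simp [term, hx, hφ, hθ]

theorem restrict_term_castSucc (p : Part) (i : Fin N) :
    restrict A N (term A p i.castSucc) = term A p i := by
  have h (b : Bool) : (Pi.single (i.castSucc, b) 1 : Fin (N + 1) × Bool → A) ∘
      (fun k : Fin N × Bool => (k.1.castSucc, k.2)) = Pi.single (i, b) 1 := by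
    funext k
    simp only [Function.comp_apply, Pi.single_apply, Prod.ext_iff, Fin.castSucc_inj]
  have hx : restrict A N (x A i.castSucc) = x A i := by simp [restrict, x]
  have hφ : restrict A N (phi A i.castSucc) = phi A i := by
    simp [restrict, phi, LinearMap.funLeft, h]
  have hθ : restrict A N (theta A i.castSucc) = theta A i := by
    simp [restrict, theta, LinearMap.funLeft, h]
  simp [term, hx, hφ, hθ]

theorem restrict_term_last {p : Part} (hp : p ≠ 0) :
    restrict A N (term A p (Fin.last N)) = 0 := by
  have h (b : Bool) : (Pi.single (Fin.last N, b) 1 : Fin (N + 1) × Bool → A) ∘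
      (fun k : Fin N × Bool => (k.1.castSucc, k.2)) = 0 := by
    funext k
    simp [Prod.ext_iff]
  have hx : restrict A N (x A (Fin.last N)) = 0 := by simp [restrict, x]
  have hφ : restrict A N (phi A (Fin.last N)) = 0 := by
    simp [restrict, phi, LinearMap.funLeft, h]
  have hθ : restrict A N (theta A (Fin.last N)) = 0 := by
    simp [restrict, theta, LinearMap.funLeft, h]
  obtain ⟨a, b, c⟩ := p
  cases b
  · cases c
    · have ha : a ≠ 0 := fun ha => hp (ha ▸ rfl)
      simp [term, hx, ha]
    · simp [term, hθ]
  · simp [term, hφ]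

theorem permute_termProd (ω : Equiv.Perm (Fin N)) (l : List (Part × Fin N)) :
    permute A ω (termProd A l) = termProd A (l.map fun p => (p.1, ω p.2)) := by
  simp [termProd, map_list_prod, permute_term, Function.comp_def]

theorem permute_termBasis (ω : Equiv.Perm (Fin N)) (f : Fin N → Part) :
    permute A ω (termBasis A N f) = termProd A (List.ofFn fun i => (f i, ω i)) := by
  rw [termBasis_apply, permute_termProd, graphList, List.map_ofFn]
  rfl

theorem exists_permute_termBasis_eq (ω : Equiv.Perm (Fin N)) (f : Fin N → Part) :
    ∃ u : ℤˣ, permute A ω (termBasis A N f) = u • termBasis A N (f ∘ ω.symm) := by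
  rw [permute_termBasis]
  refine exists_termProd_eq A fun i => ?_
  have h : (Finset.univ.filter fun k => ω k = i) = {ω.symm i} := by
    ext; simp [Equiv.eq_symm_apply]
  rw [totalDeg_ofFn f ω, h, Finset.sum_singleton, Function.comp_apply]

theorem repr_permute {ω : Equiv.Perm (Fin N)} {f : Fin N → Part} {u : ℤˣ}
    (h : permute A ω (termBasis A N f) = u • termBasis A N (f ∘ ω.symm)) (D : Superpoly A N) :
    (termBasis A N).repr (permute A ω D) (f ∘ ω.symm) = u • (termBasis A N).repr D f := by
  have key : (termBasis A N).coord (f ∘ ω.symm) ∘ₗ (permute A ω).toLinearMap =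
      Units.map (Int.castRingHom A).toMonoidHom u • (termBasis A N).coord f := by
    refine (termBasis A N).ext fun g => ?_
    by_cases hg : g = f
    · subst hg
      obtain rfl | rfl := Int.units_eq_one_or u <;> simp [h]
    · obtain ⟨v, hv⟩ := exists_permute_termBasis_eq A ω g
      have hne : g ∘ ω.symm ≠ f ∘ ω.symm := fun e => hg (ω.symm.surjective.injective_comp_right e)
      obtain rfl | rfl := Int.units_eq_one_or v <;> simp [hv, hg, hne]
  refine (LinearMap.congr_fun key D).trans ?_
  rw [LinearMap.smul_apply, intUnits_smul_eq, Module.Basis.coord_apply]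

theorem restrict_termBasis_of_eq_zero {f : Fin (N + 1) → Part} (h : f (Fin.last N) = 0) :
    restrict A N (termBasis A (N + 1) f) = termBasis A N (f ∘ Fin.castSucc) := by
  simp only [termBasis_apply, termProd, graphList, List.map_ofFn, Function.comp_def]
  rw [List.ofFn_succ', List.concat_eq_append, List.prod_append, h, term_zero]
  simp [map_list_prod, List.map_ofFn, Function.comp_def, restrict_term_castSucc]

theorem restrict_termBasis_of_ne_zero {f : Fin (N + 1) → Part} (h : f (Fin.last N) ≠ 0) :
    restrict A N (termBasis A (N + 1) f) = 0 := by
  simp only [termBasis_apply, termProd, graphList, List.map_ofFn, Function.comp_def]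
  rw [List.ofFn_succ', List.concat_eq_append, List.prod_append]
  simp [restrict_term_last A h]

/-- Restriction keeps the coefficients of the monomials in the remaining variables. -/
theorem repr_restrict {f : Fin (N + 1) → Part} (h : f (Fin.last N) = 0) (D : Superpoly A (N + 1)) :
    (termBasis A N).repr (restrict A N D) (f ∘ Fin.castSucc) = (termBasis A (N + 1)).repr D f := by
  have key : (termBasis A N).coord (f ∘ Fin.castSucc) ∘ₗ (restrict A N).toLinearMap =
      (termBasis A (N + 1)).coord f := by
    refine (termBasis A (N + 1)).ext fun g => ?_
    by_cases hg : g (Fin.last N) = 0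
    · by_cases hgf : g = f
      · subst hgf; simp [restrict_termBasis_of_eq_zero A h]
      · have hne : g ∘ Fin.castSucc ≠ f ∘ Fin.castSucc := fun e => hgf <| by
          funext i
          induction i using Fin.lastCases with
          | last => rw [hg, h]
          | cast i => exact congrFun e i
        simp [restrict_termBasis_of_eq_zero A hg, hgf, hne]
    · have hgf : g ≠ f := fun e => hg (e ▸ h)
      simp [restrict_termBasis_of_ne_zero A hg, hgf]
  exact LinearMap.congr_fun key D

/-! ### Signs -/

theorem commute_ι_mul_ι {R M : Type*} [CommRing R] [AddCommGroup M] [Module R M] (v w : M)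
    (y : ExteriorAlgebra R M) :
    Commute (ExteriorAlgebra.ι R v * ExteriorAlgebra.ι R w) y := by
  induction y using ExteriorAlgebra.induction with
  | algebraMap r => exact (Algebra.commutes r _).symm
  | ι z =>
    have h (a b : M) := eq_neg_of_add_eq_zero_left (ExteriorAlgebra.ι_add_mul_swap (R := R) a b)
    rw [Commute, SemiconjBy, mul_assoc, h w z, mul_neg, ← mul_assoc, h v z, neg_mul, neg_neg,
      mul_assoc]
  | mul a b ha hb => exact ha.mul_right hb
  | add a b ha hb => exact ha.add_right hb

/-- Terms with no mark or with both marks are central. -/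
theorem commute_term {p : Part} (hp : p.bar = p.ubar) (i : Fin N) (y : Superpoly A N) :
    Commute (term A p i) y := by
  rw [term_eq_tmul]
  induction y using TensorProduct.induction_on with
  | zero => exact Commute.zero_right _
  | add a b ha hb => exact ha.add_right hb
  | tmul a b =>
    rw [Commute, SemiconjBy, Algebra.TensorProduct.tmul_mul_tmul,
      Algebra.TensorProduct.tmul_mul_tmul, mul_comm]
    congr 1
    cases h : p.ubar
    · simp [oddVars, hp, h]
    · simpa [oddVars, hp, h] using (commute_ι_mul_ι _ _ b).eq

/-- Terms with exactly one and the same mark anticommute. -/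
theorem term_mul_term_swap {p : Part} (hp : p.bar ≠ p.ubar) (i j : Fin N) :
    term A p i * term A p j = -(term A p j * term A p i) := by
  have h (a b : Fin N × Bool → A) :=
    eq_neg_of_add_eq_zero_left (ExteriorAlgebra.ι_add_mul_swap (R := A) a b)
  rw [term_eq_tmul, term_eq_tmul, Algebra.TensorProduct.tmul_mul_tmul,
    Algebra.TensorProduct.tmul_mul_tmul, ← TensorProduct.tmul_neg, mul_comm]
  congr 1
  cases hb : p.bar <;> cases hu : p.ubar
  · simp [hb, hu] at hp
  · simpa [oddVars, hb, hu] using h _ _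
  · simpa [oddVars, hb, hu] using h _ _
  · simp [hb, hu] at hp

/-- Central factors may be permuted among themselves in a product. -/
theorem prod_ofFn_comp_perm {M : Type*} [Monoid M] {n : ℕ} (t : Fin n → M) (ω : Equiv.Perm (Fin n))
    (h : ∀ i, ω i = i ∨ ∀ y, Commute (t i) y) :
    (List.ofFn fun i => t (ω i)).prod = (List.ofFn t).prod := by
  classical
  have hsplit (s : Fin n → M) (c : Fin n → Prop) [DecidablePred c]
      (hc : ∀ i, c i → ∀ y, Commute (s i) y) (l : List (Fin n)) : (l.map s).prod =
        ((l.filter fun i => c i).map s).prod * ((l.filter fun i => ¬ c i).map s).prod := by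
    induction l with
    | nil => simp
    | cons i l ih =>
      by_cases hi : c i
      · simp [hi, ih, mul_assoc]
      · have : Commute ((l.filter fun i => c i).map s).prod (s i) :=
          Commute.list_prod_left _ _ fun y hy => by
            obtain ⟨k, hk, rfl⟩ := List.mem_map.1 hy
            exact hc k (by simpa using (List.mem_filter.1 hk).2) _
        simp only [List.map_cons, List.prod_cons, ih, hi, decide_false, Bool.false_eq_true,
          not_false_eq_true, List.filter_cons_of_neg, decide_true, List.filter_cons_of_pos]
        rw [← mul_assoc, ← this.eq, mul_assoc]
  let c : Fin n → Prop := fun i => ∀ y, Commute (t i) y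
  -- Both products have the same noncentral factors, in the same order.
  have hω (i : Fin n) : c (ω i) ↔ c i := by
    obtain hi | hi := h i
    · rw [hi]
    · refine ⟨fun _ => hi, fun _ => ?_⟩
      obtain hj | hj := h (ω i)
      · rwa [ω.injective hj]
      · exact hj
  rw [List.ofFn_eq_map, List.ofFn_eq_map, hsplit t c (fun _ hi => hi),
    hsplit (fun i => t (ω i)) c (fun i hi => (hω i).2 hi)]
  congr 1
  · refine List.Perm.prod_eq' ?_ (List.pairwise_of_forall_mem_list ?_)
    · have : List.map (fun i => t (ω i)) ((List.finRange n).filter fun i => c i) =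
          (((List.finRange n).map ω).filter fun i => c i).map t := by
        rw [List.filter_map, List.map_map]
        simp only [Function.comp_def, hω]
      rw [this]
      exact ((Equiv.Perm.map_finRange_perm ω).filter _).map _
    · intro a ha b _
      obtain ⟨k, hk, rfl⟩ := List.mem_map.1 ha
      exact (hω k).2 (by simpa using (List.mem_filter.1 hk).2) b
  · refine congrArg List.prod (List.map_congr_left fun i hi => ?_)
    rw [(h i).resolve_right (of_decide_eq_true (List.mem_filter.1 hi).2)]

/-- A permutation that only moves central factors fixes the monomial. -/
theorem permute_termBasis_eq_self {ω : Equiv.Perm (Fin N)} {f : Fin N → Part}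
    (hf : ∀ i, f (ω i) = f i) (h : ∀ i, ω i = i ∨ (f i).bar = (f i).ubar) :
    permute A ω (termBasis A N f) = termBasis A N f := by
  rw [permute_termBasis, termBasis_apply, termProd, termProd, graphList, List.map_ofFn,
    List.map_ofFn, ← prod_ofFn_comp_perm ((fun p => term A p.1 p.2) ∘ fun i => (f i, i)) ω]
  · simp only [Function.comp_def, hf]
  · exact fun i => (h i).imp_right fun hi y => commute_term A hi _ y

/-- Exchanging two positions with the same part, marked once, changes the sign: up to a sign the
monomial is the product of the two anticommuting terms at these positions and a factor without
the variables of these positions. -/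
theorem permute_swap_termBasis {f : Fin N → Part} {i j : Fin N} (hij : i ≠ j) (hf : f i = f j)
    (h : (f i).bar ≠ (f i).ubar) :
    permute A (Equiv.swap i j) (termBasis A N f) = -termBasis A N f := by
  set g : Fin N → Part := Function.update (Function.update f i 0) j 0 with hg
  have hgi : g i = 0 := by simp [hg, hij]
  have hgj : g j = 0 := by simp [hg]
  have hR : permute A (Equiv.swap i j) (termProd A (graphList g)) = termProd A (graphList g) := by
    rw [← termBasis_apply]
    refine permute_termBasis_eq_self A (fun k => ?_) fun k => ?_
    · obtain rfl | hi := eq_or_ne k i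
      · simp [hgi, hgj]
      obtain rfl | hj := eq_or_ne k j
      · simp [hgi, hgj]
      rw [Equiv.swap_apply_of_ne_of_ne hi hj]
    · obtain rfl | hi := eq_or_ne k i
      · simp only [hgi]; exact Or.inr rfl
      obtain rfl | hj := eq_or_ne k j
      · simp only [hgj]; exact Or.inr rfl
      exact Or.inl (Equiv.swap_apply_of_ne_of_ne hi hj)
  obtain ⟨u, hu⟩ := exists_termProd_eq A (l := (f i, i) :: (f j, j) :: graphList g) (f := f) <| by
    intro k
    rw [totalDeg_cons, totalDeg_cons, Pi.add_apply, Pi.add_apply, totalDeg_graphList]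
    obtain rfl | hi := eq_or_ne k i
    · simp [hgi, hij, Part.deg_zero]
    obtain rfl | hj := eq_or_ne k j
    · simp [hgj, hi, Part.deg_zero]
    simp [hi, hj, hg]
  have hT : termBasis A N f =
      u⁻¹ • (term A (f i) i * (term A (f i) j * termProd A (graphList g))) := by
    rw [eq_inv_smul_iff, ← hu, termProd_cons, termProd_cons, hf]
  have hperm : permute A (Equiv.swap i j) (term A (f i) i * (term A (f i) j *
      termProd A (graphList g))) =
        -(term A (f i) i * (term A (f i) j * termProd A (graphList g))) := by
    rw [map_mul, map_mul, hR, permute_term, permute_term, Equiv.swap_apply_left,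
      Equiv.swap_apply_right, ← mul_assoc, ← mul_assoc, term_mul_term_swap A h j i]
    exact neg_mul (term A (f i) i * term A (f i) j) (termProd A (graphList g))
  rw [hT]
  obtain h | h := Int.units_eq_one_or u⁻¹ <;> rw [h]
  · simp only [one_smul, hperm]
  · simp only [Units.neg_smul, one_smul, map_neg, hperm]

end Action

/-! ### Superpartitions and functions on the positions -/

theorem card_fiber_eq_count {α : Type*} [DecidableEq α] {n : ℕ} (f : Fin n → α) (a : α) :
    Fintype.card {i // f i = a} = (List.ofFn f).count a := by
  rw [← Multiset.coe_count, ← Fin.univ_val_map, Multiset.count_map, Fintype.card_subtype,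
    Finset.card_def, Finset.filter_val]
  simp only [eq_comm]

theorem exists_perm_of_ofFn_perm {α : Type*} [DecidableEq α] {n : ℕ} {f g : Fin n → α}
    (h : (List.ofFn f).Perm (List.ofFn g)) : ∃ σ : Equiv.Perm (Fin n), f ∘ σ = g := by
  have e (a : α) : Nonempty ({i // g i = a} ≃ {i // f i = a}) :=
    Fintype.card_eq.1 (by rw [card_fiber_eq_count, card_fiber_eq_count, h.count_eq])
  refine ⟨Equiv.ofFiberEquiv fun a => (e a).some, funext fun i => ?_⟩
  exact Equiv.ofFiberEquiv_map _ i

instance : DecidableEq SPar := fun _ _ => decidable_of_iff _ SPar.ext_iff.symm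

instance : DecidableRel Part.Before := fun p q => by unfold Part.Before; infer_instance

instance : Std.Total Part.Before := ⟨fun p q => by unfold Part.Before; omega⟩

instance : IsTrans Part Part.Before := ⟨fun p q r => by unfold Part.Before; omega⟩

instance : Std.Antisymm Part.Before := ⟨fun p q h h' => by
  obtain ⟨a, b, c⟩ := p
  obtain ⟨a', b', c'⟩ := q
  unfold Part.Before Part.rank at h h'
  dsimp only at h h'
  have hr : 2 * b.toNat + c.toNat = 2 * b'.toNat + c'.toNat := by omega
  obtain rfl : a = a' := by omega
  cases b <;> cases b' <;> cases c <;> cases c' <;> simp_all⟩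

theorem SPar.ne_zero (Λ : SPar) {p : Part} (hp : p ∈ Λ.parts) : p ≠ 0 := by
  rintro rfl
  exact lt_irrefl _ (Λ.pos 0 hp rfl rfl)

/-- The parts of a superpartition, extended by zeros, or cut off, to `N` positions. -/
def SPar.pad (Λ : SPar) (N : ℕ) : Fin N → Part := fun i => Λ.parts.getD i 0

theorem SPar.pad_length (Λ : SPar) : Λ.pad Λ.parts.length = Λ.parts.get := by
  funext i; simp [pad]

theorem SPar.pad_comp_castSucc (Λ : SPar) (N : ℕ) : Λ.pad (N + 1) ∘ Fin.castSucc = Λ.pad N := rfl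

theorem SPar.pad_last (Λ : SPar) {N : ℕ} (h : Λ.parts.length ≤ N) :
    Λ.pad (N + 1) (Fin.last N) = 0 := by
  simp [pad, h]

theorem SPar.ofFn_pad (Λ : SPar) {N : ℕ} (h : Λ.parts.length ≤ N) :
    List.ofFn (Λ.pad N) = Λ.parts ++ List.replicate (N - Λ.parts.length) 0 := by
  refine List.ext_getElem (by simp [h]) fun i h1 h2 => ?_
  rw [List.getElem_ofFn, List.getElem_append]
  by_cases hi : i < Λ.parts.length
  · simp [pad, hi]
  · simp [pad, hi]

theorem SPar.eq_of_perm {Λ Γ : SPar} (h : Λ.parts.Perm Γ.parts) : Λ = Γ :=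
  SPar.ext (h.eq_of_pairwise' Λ.sorted Γ.sorted)

theorem SPar.eq_of_pad_comp {Λ Γ : SPar} {N : ℕ} (hΛ : Λ.parts.length ≤ N)
    (hΓ : Γ.parts.length ≤ N) {σ : Equiv.Perm (Fin N)} (h : Λ.pad N ∘ σ = Γ.pad N) : Λ = Γ := by
  have hp := σ.ofFn_comp_perm (Λ.pad N)
  rw [h, ofFn_pad Γ hΓ, ofFn_pad Λ hΛ] at hp
  have hf (Ξ : SPar) : Ξ.parts.filter (· ≠ 0) = Ξ.parts :=
    List.filter_eq_self.2 fun p hp => by simpa using Ξ.ne_zero hp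
  have := hp.filter (· ≠ 0)
  rw [List.filter_append, List.filter_append, hf, hf] at this
  simp only [ne_eq, decide_not, List.filter_replicate] at this
  exact eq_of_perm (by simpa using this.symm)

/-- No part with exactly one mark is repeated. -/
def NoRepeat {N : ℕ} (f : Fin N → Part) : Prop :=
  ∀ i j, i ≠ j → f i = f j → (f i).bar = (f i).ubar

theorem NoRepeat.count_le_one {N : ℕ} {f : Fin N → Part} (hf : NoRepeat f) {p : Part}
    (hp : p.bar ≠ p.ubar) : (List.ofFn f).count p ≤ 1 := by
  by_contra! h
  obtain ⟨i, j, hij, hi, hj⟩ :=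
    List.duplicate_iff_exists_distinct_get.1 (List.duplicate_iff_two_le_count.2 h)
  rw [List.get_ofFn] at hi hj
  refine hp ?_
  rw [hi]
  exact hf _ _ (by simpa using hij.ne) (hi.symm.trans hj)

theorem SPar.noRepeat_pad (Λ : SPar) (N : ℕ) : NoRepeat (Λ.pad N) := by
  intro i j hij h
  by_contra hb
  have hne : Λ.pad N i ≠ 0 := fun h0 => hb (by rw [h0]; rfl)
  have hlt (k : Fin N) (hk : Λ.pad N k ≠ 0) : (k : ℕ) < Λ.parts.length := by
    by_contra hk'
    exact hk (by simp [pad, not_lt.1 hk'])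
  have hi := hlt i hne
  have hj := hlt j (h ▸ hne)
  have hi' : Λ.pad N i = Λ.parts[(i : ℕ)] := by simp [pad, hi]
  have hj' : Λ.pad N j = Λ.parts[(j : ℕ)] := by simp [pad, hj]
  have h1 := Λ.distinct _ (List.getElem_mem hi) (hi' ▸ hb)
  have h2 : List.Duplicate Λ.parts[(i : ℕ)] Λ.parts := by
    rw [List.duplicate_iff_exists_distinct_get]
    rw [hi', hj'] at h
    rcases lt_or_gt_of_ne hij with hlt | hlt
    · exact ⟨⟨i, hi⟩, ⟨j, hj⟩, hlt, rfl, h⟩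
    · exact ⟨⟨j, hj⟩, ⟨i, hi⟩, hlt, h, rfl⟩
  rw [List.duplicate_iff_two_le_count] at h2
  omega

/-- The values of a function without repeated parts with exactly one mark are, up to order and
zeros, the parts of a superpartition. -/
theorem NoRepeat.exists_pad {N : ℕ} {f : Fin N → Part} (hf : NoRepeat f) :
    ∃ Λ : SPar, Λ.parts.length ≤ N ∧ ∃ σ : Equiv.Perm (Fin N), f ∘ σ = Λ.pad N := by
  set l := ((List.ofFn f).filter (· ≠ 0)).insertionSort Part.Before with hl
  have hperm : l.Perm ((List.ofFn f).filter (· ≠ 0)) := List.perm_insertionSort _ _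
  have hmem {p : Part} (hp : p ∈ l) : p ∈ List.ofFn f ∧ p ≠ 0 := by
    simpa using hperm.mem_iff.1 hp
  let Λ : SPar :=
    { parts := l
      sorted := List.pairwise_insertionSort _ _
      distinct := fun p hp hb => by
        refine le_antisymm ?_ (List.count_pos_iff.2 hp)
        rw [hperm.count_eq]
        exact (List.filter_sublist.count_le p).trans (hf.count_le_one hb)
      pos := fun p hp h1 h2 => by
        obtain ⟨a, b, c⟩ := p
        dsimp only at h1 h2 ⊢
        subst h1 h2
        exact Nat.pos_of_ne_zero fun h => (hmem hp).2 (by rw [h]; rfl) }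
  have hlen : Λ.parts.length ≤ N := by
    have := List.length_filter_le (· ≠ 0) (List.ofFn f)
    rw [List.length_ofFn] at this
    exact hperm.length_eq.trans_le this
  refine ⟨Λ, hlen, exists_perm_of_ofFn_perm ?_⟩
  rw [Λ.ofFn_pad hlen]
  refine (List.filter_append_perm (· ≠ 0) (List.ofFn f)).symm.trans (hperm.symm.append ?_)
  have hz : (List.ofFn f).filter (fun p => !decide (p ≠ 0)) = List.replicate (N - l.length) 0 := by
    refine List.eq_replicate_iff.2 ⟨?_, fun p hp => by simpa using (List.mem_filter.1 hp).2⟩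
    have := (List.filter_append_perm (· ≠ 0) (List.ofFn f)).length_eq
    rw [List.length_append, List.length_ofFn] at this
    have := hperm.length_eq
    omega
  rw [hz]

/-! ### Merging parts and the weight ordering -/

/-- The weight as an additive function of the exponents. -/
def weightHom : ℕ × ℕ × ℕ →+ ℚ where
  toFun e := e.1 + (e.2.1 + e.2.2) / 2
  map_zero' := by simp
  map_add' e e' := by
    simp only [Prod.fst_add, Prod.snd_add, Nat.cast_add]
    ring

theorem weightHom_deg (p : Part) : weightHom p.deg = p.weight := rfl

theorem Part.weight_nonneg (p : Part) : 0 ≤ p.weight := by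
  unfold weight; positivity

theorem Part.weight_pos {p : Part} (hp : p ≠ 0) : 0 < p.weight := by
  refine p.weight_nonneg.lt_of_ne' fun h => hp ?_
  rw [← Part.deg_eq_zero]
  unfold weight at h
  have h1 : (0 : ℚ) ≤ p.val := Nat.cast_nonneg _
  have h2 : (0 : ℚ) ≤ p.bar.toNat := Nat.cast_nonneg _
  have h3 : (0 : ℚ) ≤ p.ubar.toNat := Nat.cast_nonneg _
  refine Prod.ext ?_ (Prod.ext ?_ ?_)
  · exact_mod_cast (by linarith : (p.val : ℚ) = 0)
  · exact_mod_cast (by linarith : (p.bar.toNat : ℚ) = 0)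
  · exact_mod_cast (by linarith : (p.ubar.toNat : ℚ) = 0)

theorem Part.Before.weight_le {p q : Part} (h : p.Before q) : q.weight ≤ p.weight := by
  obtain ⟨a, b, c⟩ := p
  obtain ⟨a', b', c'⟩ := q
  unfold weight
  obtain h | ⟨h, h'⟩ := h <;> dsimp only at h
  · have : (a' : ℚ) + 1 ≤ a := by exact_mod_cast h
    have h1 : (b'.toNat : ℚ) ≤ 1 := by exact_mod_cast b'.toNat_le
    have h2 : (c'.toNat : ℚ) ≤ 1 := by exact_mod_cast c'.toNat_le
    have h3 : (0 : ℚ) ≤ b.toNat := Nat.cast_nonneg _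
    have h4 : (0 : ℚ) ≤ c.toNat := Nat.cast_nonneg _
    dsimp only
    linarith
  · subst h
    unfold rank at h'
    cases b <;> cases b' <;> cases c <;> cases c' <;> simp_all <;> norm_num

/-- The weight of the part with index `i`, and zero if there are fewer parts. -/
def SPar.weightAt (Λ : SPar) (i : ℕ) : ℚ := (Λ.parts.getD i 0).weight

theorem SPar.partialWeight_eq_sum (Λ : SPar) (n : ℕ) :
    Λ.partialWeight n = ∑ i ∈ Finset.range n, Λ.weightAt i := by
  have (l : List Part) (n : ℕ) :
      ((l.take n).map Part.weight).sum = ∑ i ∈ Finset.range n, (l.getD i 0).weight := by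
    induction l generalizing n with
    | nil => simp [show (0 : Part).weight = 0 by rw [← weightHom_deg, Part.deg_zero, map_zero]]
    | cons p l ih =>
      cases n with
      | zero => simp
      | succ n =>
        rw [Finset.sum_range_succ', List.take_succ_cons, List.map_cons, List.sum_cons, ih, add_comm]
        simp
  exact this _ n

theorem SPar.weightAt_nonneg (Λ : SPar) (i : ℕ) : 0 ≤ Λ.weightAt i := Part.weight_nonneg _

theorem SPar.weightAt_pos (Λ : SPar) {i : ℕ} (h : i < Λ.parts.length) : 0 < Λ.weightAt i := by
  rw [weightAt, List.getD_eq_getElem _ _ h]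
  exact Part.weight_pos (Λ.ne_zero (List.getElem_mem h))

theorem SPar.weightAt_antitone (Λ : SPar) : Antitone Λ.weightAt := by
  intro i j hij
  by_cases hj : j < Λ.parts.length
  · have hi := hij.trans_lt hj
    rw [weightAt, weightAt, List.getD_eq_getElem _ _ hi, List.getD_eq_getElem _ _ hj]
    obtain rfl | hlt := hij.eq_or_lt
    · exact le_rfl
    · exact (List.pairwise_iff_getElem.1 Λ.sorted i j hi hj hlt).weight_le
  · rw [weightAt, List.getD_eq_default _ _ (not_lt.1 hj)]
    have : (0 : Part).weight = 0 := by rw [← weightHom_deg, Part.deg_zero, map_zero]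
    rw [this]
    exact Λ.weightAt_nonneg i

/-- The first `n` values of a nonnegative antitone sequence have the largest sum among all sets of
at most `n` values. -/
theorem sum_le_sum_range_of_antitone {a : ℕ → ℚ} (ha : Antitone a) (h0 : ∀ i, 0 ≤ a i) {n : ℕ}
    {J : Finset ℕ} (hJ : J.card ≤ n) : ∑ j ∈ J, a j ≤ ∑ j ∈ Finset.range n, a j := by
  rw [← Finset.sum_inter_add_sum_sdiff J (Finset.range n),
    ← Finset.sum_inter_add_sum_sdiff (Finset.range n) J, Finset.inter_comm J]
  refine add_le_add le_rfl ?_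
  have hcard : (J \ Finset.range n).card ≤ (Finset.range n \ J).card := by
    have h1 := Finset.card_inter_add_card_sdiff J (Finset.range n)
    have h2 := Finset.card_inter_add_card_sdiff (Finset.range n) J
    rw [Finset.inter_comm] at h2
    rw [Finset.card_range] at h2
    omega
  calc ∑ j ∈ J \ Finset.range n, a j ≤ (J \ Finset.range n).card • a n :=
        Finset.sum_le_card_nsmul _ _ _ fun j hj => ha (by simpa using (Finset.mem_sdiff.1 hj).2)
    _ ≤ (Finset.range n \ J).card • a n := nsmul_le_nsmul_left (h0 n) hcard
    _ ≤ ∑ j ∈ Finset.range n \ J, a j :=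
        Finset.card_nsmul_le_sum _ _ _ fun j hj =>
          ha (Finset.mem_range.1 (Finset.mem_sdiff.1 hj).1).le

section Merge

/- Throughout, the exponents of each part `j` of `Γ` are the sums of the exponents of the parts of
`Λ` that `g` sends to `j`. -/

variable {Λ Γ : SPar} {g : Fin Λ.parts.length → Fin Γ.parts.length}
  (hg : ∀ j, (Γ.parts.get j).deg = ∑ k with g k = j, (Λ.parts.get k).deg)

include hg

/-- The parts of `Γ` are nonzero, so that none of them is an empty sum. -/
theorem merge_surjective : Function.Surjective g := by
  intro j
  by_contra! h
  have h0 := hg j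
  rw [Finset.filter_false_of_mem fun k _ => h k, Finset.sum_empty, Part.deg_eq_zero] at h0
  exact Γ.ne_zero (List.get_mem _ j) h0

theorem merge_weight (j : Fin Γ.parts.length) :
    Γ.weightAt j = ∑ k with g k = j, Λ.weightAt k := by
  have hget (Ξ : SPar) (k : Fin Ξ.parts.length) : Ξ.weightAt k = weightHom (Ξ.parts.get k).deg := by
    rw [weightHom_deg, SPar.weightAt, List.getD_eq_get]
  simp only [hget, hg, map_sum]

/-- The first `n` parts of `Λ` end up in at most `n` parts of `Γ`. -/
theorem merge_partialWeight_le (n : ℕ) : Λ.partialWeight n ≤ Γ.partialWeight n := by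
  rw [SPar.partialWeight_eq_sum, SPar.partialWeight_eq_sum]
  set K : Finset (Fin Λ.parts.length) := Finset.univ.filter fun k => (k : ℕ) < n with hK
  have hKcard : K.card ≤ n := by
    calc K.card = (K.image Fin.val).card :=
          (Finset.card_image_of_injective _ Fin.val_injective).symm
      _ ≤ (Finset.range n).card := Finset.card_le_card fun k hk => by
          obtain ⟨i, hi, rfl⟩ := Finset.mem_image.1 hk
          simpa [hK] using hi
      _ = n := Finset.card_range n
  have h1 : ∑ k ∈ Finset.range n, Λ.weightAt k = ∑ k ∈ K, Λ.weightAt k := by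
    rw [← Finset.sum_image (f := Λ.weightAt) (g := Fin.val) Fin.val_injective.injOn]
    refine (Finset.sum_subset (fun k hk => ?_) fun k hk hk' => ?_).symm
    · obtain ⟨i, hi, rfl⟩ := Finset.mem_image.1 hk
      simpa [hK] using hi
    · have : Λ.parts.length ≤ k := by
        by_contra! hlt
        exact hk' (Finset.mem_image.2 ⟨⟨k, hlt⟩, by simpa [hK] using hk, rfl⟩)
      rw [SPar.weightAt, List.getD_eq_default _ _ this, ← weightHom_deg, Part.deg_zero, map_zero]
  rw [h1, ← Finset.sum_fiberwise_of_maps_to fun k hk => Finset.mem_image_of_mem g hk]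
  calc ∑ j ∈ K.image g, ∑ k ∈ K with g k = j, Λ.weightAt k
      ≤ ∑ j ∈ K.image g, Γ.weightAt j := by
        refine Finset.sum_le_sum fun j _ => ?_
        rw [merge_weight hg j]
        exact Finset.sum_le_sum_of_subset_of_nonneg
          (Finset.filter_subset_filter _ (Finset.subset_univ _)) fun k _ _ => Λ.weightAt_nonneg k
    _ = ∑ j ∈ (K.image g).image Fin.val, Γ.weightAt j :=
        (Finset.sum_image Fin.val_injective.injOn).symm
    _ ≤ ∑ j ∈ Finset.range n, Γ.weightAt j :=
        sum_le_sum_range_of_antitone Γ.weightAt_antitone Γ.weightAt_nonneg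
          (Finset.card_image_le.trans (Finset.card_image_le.trans hKcard))

/-- The partial sums differ at the length of `Γ`, where that of `Γ` is the total weight of `Λ`. -/
theorem merge_weightGT (h : Γ.parts.length < Λ.parts.length) : Γ.WeightGT Λ := by
  refine ⟨merge_partialWeight_le hg, Γ.parts.length, ?_⟩
  have htot : Γ.partialWeight Γ.parts.length = Λ.partialWeight Λ.parts.length := by
    rw [SPar.partialWeight_eq_sum, SPar.partialWeight_eq_sum, ← Fin.sum_univ_eq_sum_range,
      ← Fin.sum_univ_eq_sum_range, Finset.sum_congr rfl fun j _ => merge_weight hg j,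
      Finset.sum_fiberwise]
  rw [htot, SPar.partialWeight_eq_sum, SPar.partialWeight_eq_sum]
  exact Finset.sum_lt_sum_of_subset (Finset.range_subset_range.2 h.le) (Finset.mem_range.2 h)
    (by simp) (Λ.weightAt_pos h) fun _ _ _ => Λ.weightAt_nonneg _

theorem merge_eq_or_length_lt : Γ = Λ ∨ Γ.parts.length < Λ.parts.length := by
  have hcard := Fintype.card_le_of_surjective g (merge_surjective hg)
  rw [Fintype.card_fin, Fintype.card_fin] at hcard
  refine hcard.eq_or_lt.imp_left fun heq => ?_
  have hbij : Function.Bijective g :=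
    (Fintype.bijective_iff_surjective_and_card g).2 ⟨merge_surjective hg, by simp [heq]⟩
  have hk (k) : Λ.parts.get k = Γ.parts.get (g k) := by
    refine Part.deg_injective ?_
    have : (Finset.univ.filter fun k' => g k' = g k) = {k} := by
      ext; simp [hbij.1.eq_iff]
    rw [hg, this, Finset.sum_singleton]
  refine (SPar.eq_of_perm ?_).symm
  rw [← Multiset.coe_eq_coe]
  conv_lhs => rw [← List.ofFn_get Λ.parts]
  conv_rhs => rw [← List.ofFn_get Γ.parts]
  rw [← Fin.univ_val_map, ← Fin.univ_val_map,
    ← Multiset.map_univ_val_equiv (Equiv.ofBijective g hbij),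
    Multiset.map_map]
  exact Multiset.map_congr rfl fun k _ => hk k

theorem merge_sector : Γ.sector = Λ.sector := by
  have hsum (Ξ : SPar) : Ξ.sector = ∑ k, (Ξ.parts.get k).deg := by
    rw [← List.sum_ofFn, SPar.sector]
    have : List.ofFn (fun k => (Ξ.parts.get k).deg) = Ξ.parts.map Part.deg := by
      conv_rhs => rw [← List.ofFn_get Ξ.parts, List.map_ofFn]
      rfl
    rw [this]
    induction Ξ.parts with
    | nil => rfl
    | cons p l ih =>
      rw [List.map_cons (f := Part.deg), List.sum_cons, ← ih]
      cases hb : p.bar <;> cases hu : p.ubar <;> simp [Part.deg, hb, hu, add_comm]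
  rw [hsum, hsum, Finset.sum_congr rfl fun j _ => hg j, Finset.sum_fiberwise]

end Merge

/-! ### Symmetric superpolynomials are determined by their leading coefficients -/

section Symmetric

variable (A : Type*) [CommRing A] {N : ℕ}

theorem permute_mul (ω τ : Equiv.Perm (Fin N)) (y : Superpoly A N) :
    permute A (ω * τ) y = permute A ω (permute A τ y) := by
  have : (permute A (ω * τ)).toLinearMap =
      (permute A ω).toLinearMap ∘ₗ (permute A τ).toLinearMap := by
    refine (termBasis A N).ext fun f => ?_
    simp [permute_termBasis, permute_termProd, Function.comp_def]
  exact LinearMap.congr_fun this y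

theorem permute_one (y : Superpoly A N) : permute A 1 y = y := by
  have : (permute A (1 : Equiv.Perm (Fin N))).toLinearMap = LinearMap.id := by
    refine (termBasis A N).ext fun f => ?_
    rw [AlgHom.toLinearMap_apply, permute_termBasis, termBasis_apply]
    rfl
  exact LinearMap.congr_fun this y

theorem permute_injective (ω : Equiv.Perm (Fin N)) : Function.Injective (permute A ω) := by
  intro y z h
  have := congrArg (permute A ω⁻¹) h
  rwa [← permute_mul, ← permute_mul, inv_mul_cancel, permute_one, permute_one] at this

/-- Over a ring without 2-torsion, a symmetric superpolynomial vanishes if its coefficients at the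
leading terms of the superpartitions do. -/
theorem eq_zero_of_repr_pad_eq_zero [IsAddTorsionFree A] {D : Superpoly A N}
    (hD : ∀ ω, permute A ω D = D)
    (h : ∀ Λ : SPar, Λ.parts.length ≤ N → (termBasis A N).repr D (Λ.pad N) = 0) : D = 0 := by
  refine (termBasis A N).ext_elem fun f => ?_
  rw [map_zero, Finsupp.zero_apply]
  by_cases hf : NoRepeat f
  · obtain ⟨Λ, hΛ, σ, hσ⟩ := hf.exists_pad
    obtain ⟨u, hu⟩ := exists_permute_termBasis_eq A σ⁻¹ f
    have := repr_permute A hu D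
    rw [hD] at this
    have hσ' : f ∘ (σ⁻¹ : Equiv.Perm (Fin N)).symm = Λ.pad N := hσ
    rwa [hσ', h Λ hΛ, eq_comm, smul_eq_zero_iff_eq] at this
  · simp only [NoRepeat, not_forall] at hf
    obtain ⟨i, j, hij, hfij, hb⟩ := hf
    have hcomp : f ∘ (Equiv.swap i j).symm = f := by
      rw [Equiv.symm_swap, Equiv.comp_swap_eq_update, hfij, Function.update_eq_self, ← hfij,
        Function.update_eq_self]
    have := repr_permute A (u := -1) (by
      rw [hcomp, permute_swap_termBasis A hij hfij hb, Units.neg_smul, one_smul]) D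
    rw [hD, hcomp, Units.neg_smul, one_smul] at this
    exact self_eq_neg.1 this

/-- The restriction of a symmetric superpolynomial is symmetric. -/
theorem permute_restrict {F : Superpoly A (N + 1)} (hF : ∀ ω, permute A ω F = F)
    (ω : Equiv.Perm (Fin N)) : permute A ω (restrict A N F) = restrict A N F := by
  let ω' : Equiv.Perm (Fin (N + 1)) :=
    (finSuccEquivLast.trans (Equiv.optionCongr ω)).trans finSuccEquivLast.symm
  have hc (i : Fin N) : ω' i.castSucc = (ω i).castSucc := by simp [ω']
  have hl : ω' (Fin.last N) = Fin.last N := by simp [ω']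
  have key : (permute A ω).toLinearMap ∘ₗ (restrict A N).toLinearMap =
      (restrict A N).toLinearMap ∘ₗ (permute A ω').toLinearMap := by
    refine (termBasis A (N + 1)).ext fun f => ?_
    simp only [LinearMap.comp_apply, AlgHom.toLinearMap_apply, permute_termBasis]
    have hT : termProd A (List.ofFn fun i => (f i, ω' i)) = termProd A
        (List.ofFn fun i => (f i.castSucc, (ω i).castSucc)) *
          term A (f (Fin.last N)) (Fin.last N) := by
      rw [List.ofFn_succ', List.concat_eq_append, termProd_append, hl]
      simp only [hc]
      congr 1
      simp [termProd]
    rw [hT, map_mul]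
    by_cases h0 : f (Fin.last N) = 0
    · rw [restrict_termBasis_of_eq_zero A h0, h0, term_zero, map_one, mul_one, permute_termBasis]
      simp [termProd, map_list_prod, List.map_ofFn, Function.comp_def, restrict_term_castSucc]
    · rw [restrict_termBasis_of_ne_zero A h0, map_zero, restrict_term_last A h0, mul_zero]
  have := LinearMap.congr_fun key F
  simp only [LinearMap.comp_apply, AlgHom.toLinearMap_apply, hF] at this
  exact this

/-! ### Degrees -/

/-- The total degree of a term with the given exponents. -/
def sizeHom : ℕ × ℕ × ℕ →+ ℕ where
  toFun e := e.1 + e.2.1 + e.2.2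
  map_zero' := rfl
  map_add' e e' := by simp only [Prod.fst_add, Prod.snd_add]; ring

theorem sizeHom_deg_pos {p : Part} (hp : p ≠ 0) : 0 < sizeHom p.deg := by
  refine Nat.pos_of_ne_zero fun h => hp (Part.deg_eq_zero.1 ?_)
  change p.deg.1 + p.deg.2.1 + p.deg.2.2 = 0 at h
  exact Prod.ext (by simp; omega) (Prod.ext (by simp; omega) (by simp; omega))

theorem term_mul_mem_span {p : Part} (i : Fin N) {d e : ℕ} (hp : sizeHom p.deg = e)
    {f : Fin N → Part} (hf : ∑ k, sizeHom (f k).deg ≤ d) :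
    term A p i * termBasis A N f ∈ Submodule.span A
      (termBasis A N '' {f | ∑ k, sizeHom (f k).deg ≤ d + e}) := by
  rw [termBasis_apply, ← termProd_cons A (p, i)]
  by_cases h : ∃ f' : Fin N → Part, ∀ k, (f' k).deg = totalDeg ((p, i) :: graphList f) k
  · obtain ⟨f', hf'⟩ := h
    obtain ⟨u, hu⟩ := exists_termProd_eq A hf'
    rw [hu, ← intUnits_smul_eq A]
    refine Submodule.smul_mem _ _ (Submodule.subset_span ⟨f', ?_, rfl⟩)
    simp only [Set.mem_ofPred_eq, hf', totalDeg_cons, Pi.add_apply, totalDeg_graphList, map_add,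
      Finset.sum_add_distrib]
    have : ∑ k, sizeHom ((Pi.single i p.deg : Fin N → ℕ × ℕ × ℕ) k) = e := by
      rw [Finset.sum_eq_single i (fun k _ hk => by simp [hk]) (by simp)]
      simp [hp]
    omega
  · rw [termProd_eq_zero A h]
    exact Submodule.zero_mem _

theorem degLE_vars_le (d : ℕ) : degLE A (vars A N) d ≤
    Submodule.span A (termBasis A N '' {f | ∑ k, sizeHom (f k).deg ≤ d}) := by
  induction d with
  | zero =>
    rw [degLE, pow_zero, Submodule.one_le]
    refine Submodule.subset_span ⟨fun _ => 0, by simp [Part.deg_zero], ?_⟩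
    rw [termBasis_apply, termProd, graphList, List.map_ofFn]
    refine List.prod_eq_one fun y hy => ?_
    obtain ⟨i, rfl⟩ := List.mem_ofFn.1 hy
    exact term_zero A i
  | succ d ih =>
    rw [degLE, pow_succ', Submodule.mul_le]
    intro v hv y hy
    replace hy := ih hy
    induction hv using Submodule.span_induction with
    | zero => rw [zero_mul]; exact Submodule.zero_mem _
    | add a b _ _ ha hb => rw [add_mul]; exact Submodule.add_mem _ ha hb
    | smul r a _ ha => rw [smul_mul_assoc]; exact Submodule.smul_mem _ _ ha
    | mem v hv =>
      obtain rfl | hv := hv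
      · rw [one_mul]
        refine Submodule.span_mono (Set.image_mono fun f hf => ?_) hy
        exact Nat.le_succ_of_le hf
      obtain ⟨p, i, hp, rfl⟩ : ∃ p i, sizeHom (Part.deg p) = 1 ∧ v = term A p i := by
        obtain (⟨i, rfl⟩ | ⟨i, rfl⟩) | ⟨i, rfl⟩ := hv
        · exact ⟨⟨1, false, false⟩, i, rfl, by simp [term]⟩
        · exact ⟨⟨0, true, false⟩, i, rfl, by simp [term]⟩
        · exact ⟨⟨0, false, true⟩, i, rfl, by simp [term]⟩
      induction hy using Submodule.span_induction with
      | zero => rw [mul_zero]; exact Submodule.zero_mem _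
      | add a b _ _ ha hb => rw [mul_add]; exact Submodule.add_mem _ ha hb
      | smul r a _ ha => rw [mul_smul_comm]; exact Submodule.smul_mem _ _ ha
      | mem y hy =>
        obtain ⟨f, hf, rfl⟩ := hy
        exact term_mul_mem_span A i hp hf

theorem sum_size_le_of_repr_ne_zero {d : ℕ} {y : Superpoly A N} (hy : y ∈ degLE A (vars A N) d)
    {f : Fin N → Part} (hf : (termBasis A N).repr y f ≠ 0) : ∑ k, sizeHom (f k).deg ≤ d :=
  (termBasis A N).mem_span_image.1 (degLE_vars_le A d hy) (Finsupp.mem_support_iff.2 hf)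

theorem term_mem_degLE (p : Part) (i : Fin N) :
    term A p i ∈ degLE A (vars A N) (sizeHom p.deg) := by
  have hv {v : Superpoly A N} (hv : v ∈ vars A N) (n : ℕ) : v ^ n ∈ degLE A (vars A N) n :=
    Submodule.pow_mem_pow _ (Submodule.subset_span (Set.mem_insert_of_mem _ hv)) n
  have := degLE_mul (degLE_mul (hv (Or.inl (Or.inr ⟨i, rfl⟩)) p.bar.toNat)
    (hv (Or.inr ⟨i, rfl⟩) p.ubar.toNat)) (hv (Or.inl (Or.inl ⟨i, rfl⟩)) p.val)
  refine degLE_mono (le_of_eq ?_) this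
  change _ = p.val + p.bar.toNat + p.ubar.toNat
  ring

theorem termProd_mem_degLE (l : List (Part × Fin N)) :
    termProd A l ∈ degLE A (vars A N) (l.map fun p => sizeHom p.1.deg).sum := by
  induction l with
  | nil =>
    have := degLE_algebraMap (vars A N) 0 (1 : A)
    rwa [map_one] at this
  | cons p l ih =>
    rw [termProd_cons, List.map_cons, List.sum_cons]
    exact degLE_mul (term_mem_degLE A p.1 p.2) ih

/-! ### Monomial symmetric superfunctions -/

theorem leadingTerm_eq_termBasis (Λ : SPar) (h : Λ.parts.length ≤ N) :
    leadingTerm A Λ h = termBasis A N (Λ.pad N) := by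
  obtain ⟨m, rfl⟩ := Nat.exists_eq_add_of_le h
  rw [termBasis_apply, graphList, List.ofFn_add, termProd_append, leadingTerm]
  have h1 : termProd A (List.ofFn fun i : Fin m => (Λ.pad (Λ.parts.length + m)
      (Fin.natAdd Λ.parts.length i), Fin.natAdd Λ.parts.length i)) = 1 := by
    rw [termProd, List.map_ofFn]
    refine List.prod_eq_one fun y hy => ?_
    obtain ⟨i, rfl⟩ := List.mem_ofFn.1 hy
    simp [SPar.pad, term_zero]
  rw [h1, mul_one, termProd, List.map_ofFn]
  congr 2
  funext i
  simp [SPar.pad]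

/-- A permutation of equal parts fixes the monomial: the parts with exactly one mark stay in place,
and the other terms are central. -/
theorem permute_termBasis_eq_of_comp_eq {f : Fin N → Part} (hf : NoRepeat f)
    {ω : Equiv.Perm (Fin N)} (h : f ∘ ω = f) : permute A ω (termBasis A N f) = termBasis A N f := by
  refine permute_termBasis_eq_self A (congrFun h) fun i => ?_
  by_cases hi : ω i = i
  · exact Or.inl hi
  · exact Or.inr (hf i (ω i) (Ne.symm hi) (congrFun h i).symm)

theorem monomial_apply_of_lt {Λ : SPar} (h : N < Λ.parts.length) : monomial A Λ N = 0 := by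
  rw [monomial, dif_neg (not_le.2 h)]

open Classical in
theorem monomial_apply {Λ : SPar} (h : Λ.parts.length ≤ N) : monomial A Λ N =
    ∑ y ∈ Finset.univ.image
      fun ω : Equiv.Perm (Fin N) => permute A ω (termBasis A N (Λ.pad N)), y := by
  rw [monomial, dif_pos h, leadingTerm_eq_termBasis]

theorem permute_monomial (Λ : SPar) (ω : Equiv.Perm (Fin N)) :
    permute A ω (monomial A Λ N) = monomial A Λ N := by
  classical
  by_cases h : Λ.parts.length ≤ N
  · rw [monomial_apply A h, map_sum,
      ← Finset.sum_image (f := fun y => y) (permute_injective A ω).injOn]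
    congr 1
    rw [Finset.image_image]
    ext y
    simp only [Finset.mem_image, Finset.mem_univ, true_and, Function.comp_apply, ← permute_mul]
    exact (Equiv.mulLeft ω).exists_congr_left.trans (by simp)
  · rw [monomial_apply_of_lt A (not_le.1 h), map_zero]

/-- The monomials are dual to the coefficients at the leading terms. -/
theorem repr_monomial_pad {Λ Γ : SPar} (h : Λ.parts.length ≤ N) :
    (termBasis A N).repr (monomial A Γ N) (Λ.pad N) = if Γ = Λ then 1 else 0 := by
  classical
  by_cases hΓ : Γ.parts.length ≤ N
  · have key (ω : Equiv.Perm (Fin N))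
        (hω : (termBasis A N).repr (permute A ω (termBasis A N (Γ.pad N))) (Λ.pad N) ≠ 0) :
        Γ.pad N ∘ ω.symm = Λ.pad N := by
      obtain ⟨u, hu⟩ := exists_permute_termBasis_eq A ω (Γ.pad N)
      by_contra hne
      apply hω
      obtain rfl | rfl := Int.units_eq_one_or u <;> simp [hu, hne]
    rw [monomial_apply A hΓ, map_sum, Finsupp.finsetSum_apply]
    split_ifs with heq
    · subst heq
      rw [Finset.sum_eq_single (termBasis A N (Γ.pad N))]
      · simp
      · intro y hy hne
        obtain ⟨ω, -, rfl⟩ := Finset.mem_image.1 hy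
        by_contra h0
        refine hne (permute_termBasis_eq_of_comp_eq A (Γ.noRepeat_pad N) ?_)
        conv_lhs => rw [← key ω h0]
        funext i; simp
      · exact fun hn => (hn (Finset.mem_image.2 ⟨1, Finset.mem_univ _, permute_one A _⟩)).elim
    · refine Finset.sum_eq_zero fun y hy => ?_
      obtain ⟨ω, -, rfl⟩ := Finset.mem_image.1 hy
      by_contra h0
      exact heq (SPar.eq_of_pad_comp hΓ h (key ω h0))
  · have : Γ ≠ Λ := fun e => hΓ (e ▸ h)
    simp [monomial_apply_of_lt A (not_le.1 hΓ), this]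

/-- Both sides are symmetric, so it suffices to compare the coefficients at leading terms. -/
theorem restrict_monomial [IsAddTorsionFree A] (Λ : SPar) (N : ℕ) :
    restrict A N (monomial A Λ (N + 1)) = monomial A Λ N := by
  rw [← sub_eq_zero]
  refine eq_zero_of_repr_pad_eq_zero A (fun ω => ?_) fun Γ hΓ => ?_
  · rw [map_sub, permute_monomial, permute_restrict A (permute_monomial A Λ)]
  · rw [map_sub, Finsupp.sub_apply, repr_monomial_pad A hΓ, ← SPar.pad_comp_castSucc,
      repr_restrict A (Γ.pad_last hΓ), repr_monomial_pad A (Nat.le_succ_of_le hΓ), sub_self]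

theorem monomial_mem_degLE (Λ : SPar) (N : ℕ) : monomial A Λ N ∈
    degLE A (vars A N) (Λ.parts.map fun p => sizeHom p.deg).sum := by
  classical
  by_cases h : Λ.parts.length ≤ N
  · rw [monomial, dif_pos h]
    refine Submodule.sum_mem _ fun y hy => ?_
    obtain ⟨ω, -, rfl⟩ := Finset.mem_image.1 hy
    have : leadingTerm A Λ h = termProd A (List.ofFn fun i => (Λ.parts.get i, Fin.castLE h i)) := by
      rw [termProd, List.map_ofFn]; rfl
    rw [this, permute_termProd]
    convert termProd_mem_degLE A _ using 2
    rw [List.map_map, List.map_ofFn]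
    conv_lhs => rw [← List.ofFn_get Λ.parts, List.map_ofFn]
    rfl
  · rw [monomial_apply_of_lt A (not_le.1 h)]
    exact Submodule.zero_mem _

theorem monomial_mem_symSuper [IsAddTorsionFree A] (Λ : SPar) : monomial A Λ ∈ SymSuper A :=
  ⟨fun _ => permute_monomial A Λ, restrict_monomial A Λ, _, monomial_mem_degLE A Λ⟩

/-- The coefficient of the leading term of `Λ` in a sequence of superpolynomials, taken in the
smallest possible number of variables. -/
noncomputable def SPar.coeff (Λ : SPar) : (∀ N : ℕ, Superpoly A N) →ₗ[A] A :=
  (termBasis A Λ.parts.length).coord (Λ.pad Λ.parts.length) ∘ₗ LinearMap.proj Λ.parts.length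

theorem SPar.coeff_apply (Λ : SPar) (F : ∀ N : ℕ, Superpoly A N) : Λ.coeff A F =
    (termBasis A Λ.parts.length).repr (F Λ.parts.length) (Λ.pad Λ.parts.length) := rfl

theorem SPar.coeff_monomial (Λ Γ : SPar) : Λ.coeff A (monomial A Γ) = if Γ = Λ then 1 else 0 :=
  repr_monomial_pad A le_rfl

theorem SPar.repr_pad_eq_coeff {F : ∀ N : ℕ, Superpoly A N}
    (hF : ∀ N, restrict A N (F (N + 1)) = F N) (Λ : SPar) {N : ℕ} (h : Λ.parts.length ≤ N) :
    (termBasis A N).repr (F N) (Λ.pad N) = Λ.coeff A F := by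
  induction N, h using Nat.le_induction with
  | base => rfl
  | succ N hN ih => rw [← ih, ← hF N, ← SPar.pad_comp_castSucc Λ N, repr_restrict A (Λ.pad_last hN)]

/-- Over a ring without 2-torsion every symmetric superfunction is a finite linear combination of
the monomials. -/
theorem exists_eq_sum_monomial [IsAddTorsionFree A] {F : ∀ N : ℕ, Superpoly A N}
    (hF : F ∈ SymSuper A) : ∃ c : SPar →₀ A, (∀ Λ, c Λ = Λ.coeff A F) ∧
      F = c.sum fun Λ a => a • monomial A Λ := by
  obtain ⟨hperm, hres, d, hd⟩ := hF
  -- Each part contributes at least one to the degree, so only finitely many variables matter.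
  have hlen {Λ : SPar} (h : Λ.coeff A F ≠ 0) : Λ.parts.length ≤ d := by
    have := sum_size_le_of_repr_ne_zero A (hd _) h
    refine le_trans ?_ this
    rw [SPar.pad_length]
    calc Λ.parts.length = ∑ _k : Fin Λ.parts.length, 1 := by simp
      _ ≤ _ := Finset.sum_le_sum fun k _ => sizeHom_deg_pos (Λ.ne_zero (List.get_mem _ k))
  have hfin : (Function.support fun Λ : SPar => Λ.coeff A F).Finite := by
    refine Set.Finite.of_finite_image (f := fun Λ => Λ.pad d)
      (((termBasis A d).repr (F d)).support.finite_toSet.subset ?_) ?_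
    · rintro _ ⟨Λ, hΛ, rfl⟩
      rw [Finset.mem_coe, Finsupp.mem_support_iff, Λ.repr_pad_eq_coeff A hres (hlen hΛ)]
      exact hΛ
    · intro Λ hΛ Γ hΓ h
      exact SPar.eq_of_pad_comp (hlen hΛ) (hlen hΓ) (σ := 1) h
  refine ⟨Finsupp.ofSupportFinite _ hfin, fun _ => rfl, ?_⟩
  set c := Finsupp.ofSupportFinite _ hfin
  have hG : (c.sum fun Λ a => a • monomial A Λ) ∈ SymSuper A :=
    Submodule.sum_mem (Subalgebra.toSubmodule (SymSuper A)) fun Λ _ =>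
      Subalgebra.smul_mem _ (monomial_mem_symSuper A Λ) _
  obtain ⟨hGperm, hGres, -⟩ := hG
  funext N
  rw [← sub_eq_zero]
  refine eq_zero_of_repr_pad_eq_zero A (fun ω => ?_) fun Γ hΓ => ?_
  · rw [map_sub, hperm, hGperm]
  · rw [map_sub, Finsupp.sub_apply, Γ.repr_pad_eq_coeff A hres hΓ, Γ.repr_pad_eq_coeff A hGres hΓ,
      Finsupp.sum, map_sum]
    simp only [map_smul, SPar.coeff_monomial, smul_eq_mul, mul_ite, mul_one, mul_zero]
    rw [Finset.sum_ite_eq']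
    split_ifs with h
    · exact sub_self _
    · rw [sub_zero]
      have : c Γ = 0 := Finsupp.notMem_support_iff.1 h
      exact this

end Symmetric

/-! ### Power sums -/

section PowerSums

variable (A : Type*) [CommRing A]

theorem powerSumPart_mem_symSuper {p : Part} (hp : p ≠ 0) : powerSumPart A p ∈ SymSuper A := by
  refine ⟨fun N ω => ?_, fun N => ?_, sizeHom p.deg, fun N => ?_⟩
  · simp only [powerSumPart, map_sum, permute_term]
    exact Equiv.sum_comp ω fun i => term A p i
  · simp only [powerSumPart, Fin.sum_univ_castSucc, map_add, map_sum, restrict_term_castSucc,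
      restrict_term_last A hp, add_zero]
  · exact Submodule.sum_mem _ fun i _ => term_mem_degLE A p i

theorem powerSum_mem_symSuper (Λ : SPar) : powerSum A Λ ∈ SymSuper A := by
  refine Subalgebra.list_prod_mem _ fun y hy => ?_
  obtain ⟨p, hp, rfl⟩ := List.mem_map.1 hy
  exact powerSumPart_mem_symSuper A (Λ.ne_zero hp)

theorem prod_ofFn_sum_term {n N : ℕ} (q : Fin n → Part) :
    (List.ofFn fun k => ∑ i : Fin N, term A (q k) i).prod =
      ∑ g : Fin n → Fin N, termProd A (List.ofFn fun k => (q k, g k)) := by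
  induction n with
  | zero => simp [termProd]
  | succ n ih =>
    rw [List.ofFn_succ, List.prod_cons, ih fun k => q k.succ, Finset.sum_mul_sum,
      ← (Fin.consEquiv fun _ : Fin (n + 1) => Fin N).sum_comp, Fintype.sum_prod_type]
    refine Finset.sum_congr rfl fun i _ => Finset.sum_congr rfl fun g _ => ?_
    rw [List.ofFn_succ, termProd_cons]
    rfl

theorem powerSum_apply (Λ : SPar) (N : ℕ) : powerSum A Λ N =
    ∑ g : Fin Λ.parts.length → Fin N, termProd A (List.ofFn fun k => (Λ.parts.get k, g k)) := by
  rw [← prod_ofFn_sum_term, powerSum, Pi.list_prod_apply, List.map_map]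
  conv_lhs => rw [← List.ofFn_get Λ.parts, List.map_ofFn]
  rfl

theorem SPar.deg_get_of_repr_ne_zero {Λ Γ : SPar} {g : Fin Λ.parts.length → Fin Γ.parts.length}
    (h : (termBasis A Γ.parts.length).repr
      (termProd A (List.ofFn fun k => (Λ.parts.get k, g k))) (Γ.pad Γ.parts.length) ≠ 0)
    (j : Fin Γ.parts.length) :
    (Γ.parts.get j).deg = ∑ k with g k = j, (Λ.parts.get k).deg := by
  have := totalDeg_of_repr_ne_zero A h j
  rwa [SPar.pad_length, totalDeg_ofFn] at this

/-- The monomials in a power sum arise by merging parts. -/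
theorem exists_merge_of_coeff_powerSum_ne_zero {Λ Γ : SPar} (h : Γ.coeff A (powerSum A Λ) ≠ 0) :
    ∃ g : Fin Λ.parts.length → Fin Γ.parts.length,
      ∀ j, (Γ.parts.get j).deg = ∑ k with g k = j, (Λ.parts.get k).deg := by
  rw [SPar.coeff_apply, powerSum_apply, map_sum, Finsupp.finsetSum_apply] at h
  obtain ⟨g, -, hg⟩ := Finset.exists_ne_zero_of_sum_ne_zero h
  exact ⟨g, SPar.deg_get_of_repr_ne_zero A hg⟩

/-- The leading coefficient counts the permutations of equal parts. -/
theorem coeff_powerSum_self (Λ : SPar) : Λ.coeff A (powerSum A Λ) = Λ.leadCoeff := by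
  classical
  rw [SPar.coeff_apply, powerSum_apply, map_sum, Finsupp.finsetSum_apply]
  set n := Λ.parts.length
  have hpad : Λ.pad n = Λ.parts.get := Λ.pad_length
  set F : (Fin n → Fin n) → A := fun g => (termBasis A n).repr
      (termProd A (List.ofFn fun k => (Λ.parts.get k, g k))) (Λ.pad n) with hF
  have h1 : ∑ g, F g = ∑ σ : Equiv.Perm (Fin n), F σ := by
    -- Only surjective, hence bijective, maps of positions contribute.
    rw [← Finset.sum_image (s := Finset.univ)
      (g := fun σ : Equiv.Perm (Fin n) => (σ : Fin n → Fin n))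
      (fun _ _ _ _ h => DFunLike.coe_injective h)]
    refine (Finset.sum_subset (Finset.subset_univ _) fun g _ hg => ?_).symm
    by_contra h
    have hs := merge_surjective (SPar.deg_get_of_repr_ne_zero A h)
    exact hg (Finset.mem_image.2
      ⟨Equiv.ofBijective g
        (Finite.injective_iff_bijective.1 (Finite.injective_iff_surjective.2 hs)), Finset.mem_univ _, rfl⟩)
  have h2 (σ : Equiv.Perm (Fin n)) : F σ = if Λ.parts.get ∘ σ = Λ.parts.get then 1 else 0 := by
    split_ifs with h
    · have hT := permute_termBasis_eq_of_comp_eq A (Λ.noRepeat_pad n) (ω := σ)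
        (by rw [hpad]; exact h)
      rw [permute_termBasis, hpad] at hT
      simp only [hF]
      rw [hT, hpad, Module.Basis.repr_self, Finsupp.single_eq_same]
    · by_contra h0
      have hg := SPar.deg_get_of_repr_ne_zero A h0
      refine h (funext fun k => Part.deg_injective ?_)
      have hk : (Finset.univ.filter fun k' => σ k' = σ k) = {k} := by ext; simp
      have := hg (σ k)
      rwa [hk, Finset.sum_singleton] at this
  change ∑ g, F g = _
  rw [h1, Finset.sum_congr rfl fun σ _ => h2 σ, Finset.sum_boole, ← Fintype.card_subtype,
    DomMulAct.stabilizer_card', SPar.leadCoeff]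
  congr 1
  have hi : Finset.univ.image Λ.parts.get = Λ.parts.toFinset := by
    ext p; simp [List.mem_iff_get]
  rw [hi]
  refine Finset.prod_congr rfl fun p _ => ?_
  rw [card_fiber_eq_count, List.ofFn_get]

theorem leadCoeff_ne_zero (Λ : SPar) : Λ.leadCoeff ≠ 0 :=
  Finset.prod_ne_zero_iff.2 fun _ _ => Nat.factorial_ne_zero _

/-- The expansion of a power sum in monomials, with the leading term split off. -/
theorem exists_powerSum_eq [CharZero A] [IsAddTorsionFree A] (Λ : SPar) : ∃ c : SPar →₀ A,
    (∀ Γ, c Γ ≠ 0 → (Γ.WeightGT Λ ∧ Γ.sector = Λ.sector) ∧ Γ.parts.length < Λ.parts.length) ∧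
    powerSum A Λ = Λ.leadCoeff • monomial A Λ + c.sum fun Γ a => a • monomial A Γ := by
  obtain ⟨c, hc, hsum⟩ := exists_eq_sum_monomial A (powerSum_mem_symSuper A Λ)
  have hΛ : c Λ = Λ.leadCoeff := (hc Λ).trans (coeff_powerSum_self A Λ)
  refine ⟨c.erase Λ, fun Γ hΓ => ?_, ?_⟩
  · have hne : Γ ≠ Λ := by rintro rfl; simp at hΓ
    rw [Finsupp.erase_ne hne, hc] at hΓ
    obtain ⟨g, hg⟩ := exists_merge_of_coeff_powerSum_ne_zero A hΓ
    have hlt := (merge_eq_or_length_lt hg).resolve_left hne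
    exact ⟨⟨merge_weightGT hg hlt, merge_sector hg⟩, hlt⟩
  · have := Finsupp.add_sum_erase c Λ (fun Γ a => a • monomial A Γ) <| by
      rw [Finsupp.mem_support_iff, hΛ]
      exact Nat.cast_ne_zero.2 (leadCoeff_ne_zero Λ)
    rw [hsum, ← this, hΛ, Nat.cast_smul_eq_nsmul]

end PowerSums

/-! ### Change of the ring of coefficients -/

section BaseChange

variable (A : Type*) [CommRing A]

/-- There is a ring homomorphism from the superpolynomials with integer coefficients that sends
the variables to the variables. -/
theorem exists_baseChange (N : ℕ) : ∃ ψ : Superpoly ℤ N →+* Superpoly A N,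
    ∀ p i, ψ (term ℤ p i) = term A p i := by
  let c : (Fin N × Bool → ℤ) →ₗ[ℤ] (Fin N × Bool → A) :=
    (RingHom.pi fun k =>
      (Int.castRingHom A).comp (Pi.evalRingHom _ k)).toAddMonoidHom.toIntLinearMap
  let f : MvPolynomial (Fin N) ℤ →+* Superpoly A N :=
    (Algebra.TensorProduct.includeLeft :
      MvPolynomial (Fin N) A →ₐ[A] Superpoly A N).toRingHom.comp
      (MvPolynomial.map (Int.castRingHom A))
  let o : (Fin N × Bool → ℤ) →ₗ[ℤ] ExteriorAlgebra A (Fin N × Bool → A) :=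
    ((ExteriorAlgebra.ι A).toAddMonoidHom.comp c.toAddMonoidHom).toIntLinearMap
  let e : ExteriorAlgebra ℤ (Fin N × Bool → ℤ) →+* ExteriorAlgebra A (Fin N × Bool → A) :=
    (ExteriorAlgebra.lift ℤ ⟨o, fun v => ExteriorAlgebra.ι_sq_zero (R := A) (c v)⟩).toRingHom
  let g : ExteriorAlgebra ℤ (Fin N × Bool → ℤ) →+* Superpoly A N :=
    (Algebra.TensorProduct.includeRight :
      ExteriorAlgebra A (Fin N × Bool → A) →ₐ[A] Superpoly A N).toRingHom.comp e
  have hfg (a b) : Commute (f.toIntAlgHom a) (g.toIntAlgHom b) := by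
    change _ ⊗ₜ[A] 1 * 1 ⊗ₜ[A] _ = 1 ⊗ₜ[A] _ * _ ⊗ₜ[A] 1
    simp only [Algebra.TensorProduct.tmul_mul_tmul, one_mul, mul_one]
  let ψ := Algebra.TensorProduct.lift f.toIntAlgHom g.toIntAlgHom hfg
  have hcv (v k) : c v k = (v k : A) := rfl
  have hc (k) : c (Pi.single k 1) = Pi.single k 1 := by
    funext k'
    by_cases h : k' = k
    · subst h; simp [hcv]
    · simp [hcv, h]
  have hx (i : Fin N) : ψ (x ℤ i) = x A i := by
    simp [ψ, x, f]
  have he (v) : e (ExteriorAlgebra.ι ℤ v) = ExteriorAlgebra.ι A (c v) :=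
    ExteriorAlgebra.lift_ι_apply ℤ o _ v
  have hφ (i : Fin N) : ψ (phi ℤ i) = phi A i := by
    simp [ψ, phi, g, he, hc]
  have hθ (i : Fin N) : ψ (theta ℤ i) = theta A i := by
    simp [ψ, theta, g, he, hc]
  refine ⟨ψ.toRingHom, fun p i => ?_⟩
  change ψ (term ℤ p i) = _
  rw [term, map_mul, map_mul, map_pow, map_pow, map_pow, hx, hφ, hθ, term]

variable {A} {N : ℕ} {ψ : Superpoly ℤ N →+* Superpoly A N}
  (hψ : ∀ p i, ψ (term ℤ p i) = term A p i)

include hψ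

theorem baseChange_termProd (l : List (Part × Fin N)) : ψ (termProd ℤ l) = termProd A l := by
  simp [termProd, map_list_prod, hψ, Function.comp_def]

theorem baseChange_powerSum (Λ : SPar) : ψ (powerSum ℤ Λ N) = powerSum A Λ N := by
  simp only [powerSum_apply, map_sum, baseChange_termProd hψ]

/-- Distinct monomials in an orbit stay distinct over every nontrivial ring, so that the orbit sums
correspond. -/
theorem baseChange_monomial [Nontrivial A] (Λ : SPar) :
    ψ (monomial ℤ Λ N) = monomial A Λ N := by
  classical
  by_cases h : Λ.parts.length ≤ N
  · have hperm (ω : Equiv.Perm (Fin N)) : ψ (permute ℤ ω (termBasis ℤ N (Λ.pad N))) =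
        permute A ω (termBasis A N (Λ.pad N)) := by
      rw [permute_termBasis, permute_termBasis, baseChange_termProd hψ]
    rw [monomial_apply A h, monomial_apply ℤ h, map_sum,
      ← Finset.sum_image (f := fun y => y) (g := ψ),
      Finset.image_image]
    · simp only [Function.comp_def, hperm]
    · intro y hy z hz hyz
      obtain ⟨ω, -, rfl⟩ := Finset.mem_image.1 hy
      obtain ⟨τ, -, rfl⟩ := Finset.mem_image.1 hz
      rw [hperm, hperm] at hyz
      obtain ⟨u, hu⟩ := exists_permute_termBasis_eq A ω (Λ.pad N)
      obtain ⟨v, hv⟩ := exists_permute_termBasis_eq A τ (Λ.pad N)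
      have hfix : Λ.pad N ∘ ω.symm = Λ.pad N ∘ τ.symm := by
        by_contra hne
        have := congrArg (fun y => (termBasis A N).repr y (Λ.pad N ∘ ω.symm))
          (hu.symm.trans (hyz.trans hv))
        obtain rfl | rfl := Int.units_eq_one_or u <;>
          obtain rfl | rfl := Int.units_eq_one_or v <;> simp [Ne.symm hne] at this
      have hstab : Λ.pad N ∘ (τ⁻¹ * ω : Equiv.Perm (Fin N)) = Λ.pad N := by
        funext i
        simpa using (congrFun hfix (ω i)).symm
      calc permute ℤ ω (termBasis ℤ N (Λ.pad N))
          = permute ℤ τ (permute ℤ (τ⁻¹ * ω) (termBasis ℤ N (Λ.pad N))) := by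
            rw [← permute_mul, mul_inv_cancel_left]
        _ = permute ℤ τ (termBasis ℤ N (Λ.pad N)) := by
            rw [permute_termBasis_eq_of_comp_eq ℤ (Λ.noRepeat_pad N) hstab]
  · rw [monomial_apply_of_lt A (not_le.1 h), monomial_apply_of_lt ℤ (not_le.1 h), map_zero]

end BaseChange

/-! ### Power sums as a basis -/

theorem linearIndependent_powerSum : LinearIndependent ℚ (powerSum ℚ) := by
  rw [linearIndependent_iff]
  intro l hl
  by_contra hne
  -- At a superpartition of maximal length in the relation only its own power sum contributes.
  obtain ⟨Λ, hΛ, hmax⟩ := l.support.exists_max_image (fun Λ => Λ.parts.length)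
    (Finsupp.support_nonempty_iff.2 hne)
  have h0 : Λ.coeff ℚ (Finsupp.linearCombination ℚ (powerSum ℚ) l) = 0 := by rw [hl, map_zero]
  rw [Finsupp.linearCombination_apply, Finsupp.sum, map_sum, Finset.sum_eq_single Λ] at h0
  · rw [map_smul, coeff_powerSum_self, smul_eq_mul, mul_eq_zero] at h0
    exact h0.elim (Finsupp.mem_support_iff.1 hΛ) (Nat.cast_ne_zero.2 (leadCoeff_ne_zero Λ))
  · intro Γ hΓ hΓΛ
    rw [map_smul]
    by_contra h
    obtain ⟨g, hg⟩ := exists_merge_of_coeff_powerSum_ne_zero ℚ (right_ne_zero_of_smul h)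
    exact ((merge_eq_or_length_lt hg).resolve_left hΓΛ.symm).not_ge (hmax Γ hΓ)
  · exact fun h => absurd hΛ h

/-- The triangular expansion of the power sums is inverted by induction on the length. -/
theorem monomial_mem_span_powerSum (Λ : SPar) :
    monomial ℚ Λ ∈ Submodule.span ℚ (Set.range (powerSum ℚ)) := by
  induction hn : Λ.parts.length using Nat.strong_induction_on generalizing Λ with
  | _ n ih =>
    obtain ⟨c, hc, hp⟩ := exists_powerSum_eq ℚ Λ
    have hlead : (Λ.leadCoeff : ℚ) ≠ 0 := Nat.cast_ne_zero.2 (leadCoeff_ne_zero Λ)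
    rw [← Submodule.smul_mem_iff _ hlead, Nat.cast_smul_eq_nsmul, ← sub_eq_iff_eq_add.2 hp]
    refine Submodule.sub_mem _ (Submodule.subset_span ⟨Λ, rfl⟩) (Submodule.sum_mem _ fun Γ hΓ => ?_)
    exact Submodule.smul_mem _ _
      (ih _ (hn ▸ (hc Γ (Finsupp.mem_support_iff.1 hΓ)).2) Γ rfl)

theorem exists_powerSum_basis : ∃ b : Module.Basis SPar ℚ (SymSuper ℚ),
    ∀ Λ : SPar, (b Λ : ∀ N : ℕ, Superpoly ℚ N) = powerSum ℚ Λ := by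
  let v (Λ : SPar) : SymSuper ℚ := ⟨powerSum ℚ Λ, powerSum_mem_symSuper ℚ Λ⟩
  have hv : (SymSuper ℚ).val.toLinearMap ∘ v = powerSum ℚ := rfl
  have hli : LinearIndependent ℚ v :=
    LinearIndependent.of_comp (SymSuper ℚ).val.toLinearMap (hv ▸ linearIndependent_powerSum)
  have hsp : ⊤ ≤ Submodule.span ℚ (Set.range v) := by
    intro F _
    have hF : F.1 ∈ Submodule.span ℚ (Set.range (powerSum ℚ)) := by
      obtain ⟨c, -, hc⟩ := exists_eq_sum_monomial ℚ F.2
      rw [hc]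
      exact Submodule.sum_mem _ fun Γ _ => Submodule.smul_mem _ _ (monomial_mem_span_powerSum Γ)
    rw [← hv, Set.range_comp, ← Submodule.map_span] at hF
    obtain ⟨G, hG, hGF⟩ := hF
    rwa [Subtype.ext hGF] at hG
  exact ⟨Module.Basis.mk hli hsp, fun Λ => by rw [Module.Basis.mk_apply]⟩

end SuperSym

theorem mainTheorem9 :
    (∃ a : SuperSym.SPar → SuperSym.SPar →₀ ℤ,
      (∀ Λ Γ : SuperSym.SPar, a Λ Γ ≠ 0 → Γ.WeightGT Λ ∧ Γ.sector = Λ.sector) ∧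
      ∀ (A : Type*) [CommRing A] (Λ : SuperSym.SPar),
        SuperSym.powerSum A Λ =
          Λ.leadCoeff • SuperSym.monomial A Λ +
            (a Λ).sum fun Γ c => c • SuperSym.monomial A Γ) ∧
    ∃ b : Module.Basis SuperSym.SPar ℚ (SuperSym.SymSuper ℚ),
      ∀ Λ : SuperSym.SPar,
        (b Λ : ∀ N : ℕ, SuperSym.Superpoly ℚ N) = SuperSym.powerSum ℚ Λ := by
  refine ⟨?_, SuperSym.exists_powerSum_basis⟩
  choose a ha hsum using SuperSym.exists_powerSum_eq ℤ
  refine ⟨a, fun Λ Γ h => (ha Λ Γ h).1, fun A _ Λ => funext fun N => ?_⟩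
  -- Over the trivial ring the orbit sums collapse, but so does the ring of superpolynomials.
  obtain hA | hA := subsingleton_or_nontrivial A
  · have : Subsingleton (SuperSym.Superpoly A N) := Module.subsingleton A _
    exact Subsingleton.elim _ _
  obtain ⟨ψ, hψ⟩ := SuperSym.exists_baseChange A N
  have h := congrArg ψ (congrFun (hsum Λ) N)
  rw [SuperSym.baseChange_powerSum hψ] at h
  rw [h, Pi.add_apply, Pi.add_apply, map_add, Finsupp.sum, Finsupp.sum, Finset.sum_apply,
    Finset.sum_apply, map_sum, Pi.smul_apply, Pi.smul_apply, map_nsmul,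
    SuperSym.baseChange_monomial hψ]
  congr 1
  refine Finset.sum_congr rfl fun Γ _ => ?_
  rw [Pi.smul_apply, Pi.smul_apply, ← SuperSym.baseChange_monomial hψ]
  exact map_zsmul ψ _ _
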